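/- Let $\Bbbk$ be a field of characteristic $0$, let $n\ge 2$ and $N\ge 1$ be integers. *Notation.* $B_n$ is the braid group with Artin generators $\sigma_1,\dots,\sigma_{n-1}$, $P_n$ is the kernel of $B_n\to\mathfrak S_n$, $\sigma_i\mapsto s_i=(i\ i{+}1)$; for $1\le i<j\le n$ let $\xi_{ij}=\sigma_{j-1}\cdots\sigma_{i+1}\sigma_i^2\sigma_{i+1}^{-1}\cdots\sigma_{j-1}^{-1}\in P_n$, and let $F_n\subset P_n$ be the subgroup generated by $\xi_{1n},\dots,\xi_{n-1,n}$. $\mathcal T_n$ is the Lie algebra over $\Bbbk$ with generators $t_{ij}$ ($1\le i,j\le n$) and relations $t_{ij}=t_{ji}$, $t_{ii}=0$, $[t_{ij},t_{kl}]=0$ if $i,j,k,l$ are distinct, $[t_{ij},t_{ik}+t_{kj}]=0$; $\mathfrak F_n\subset\mathcal T_n$ is the Lie subalgebra generated by $t_{1n},\dots,t_{n-1,n}$; $\mathfrak B_n=\Bbbk\mathfrak S_n\ltimes \mathsf U\mathcal T_n$ with $s\,t_{ij}\,s^{-1}=t_{s(i)s(j)}$; and $Y_r=\sum_{i<r}t_{ir}$.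 For $\lambda\in\Bbbk$, $\mathrm{Assoc}_\lambda(\Bbbk)$ is the set of Drinfeld associators: formal series $\Phi(A,B)$ over $\Bbbk$ in two non-commuting variables with $\Delta(\Phi)=\Phi\hat\otimes\Phi$ (for $A$, $B$ primitive), $\Phi(B,A)=\Phi(A,B)^{-1}$, $e^{\lambda A}\Phi(C,A)e^{\lambda C}\Phi(B,C)e^{\lambda B}\Phi(A,B)=1$ where $C=-A-B$, and, in $\widehat{\mathsf U\mathcal T_4}$ (completed for the grading $\deg t_{ij}=1$), $$\Phi(t_{12},t_{23}+t_{24})\,\Phi(t_{13}+t_{23},t_{34})=\Phi(t_{23},t_{34})\,\Phi(t_{12}+t_{13},t_{24}+t_{34})\,\Phi(t_{12},t_{23}).$$ *Setting.* Let $\lambda\in\Bbbk^\times$, $\Phi\in\mathrm{Assoc}_\lambda(\Bbbk)$, and let $\rho:\mathfrak B_n\to M_N(\Bbbk)$ be a representation. Let $R=\widehat\Phi(\rho):B_n\to GL_N(\Bbbk[[h]])$ be the representation obtained from Drinfeld's morphism $$\sigma_i\mapsto \Phi(t_{i,i+1},Y_i)\,s_i\,e^{\lambda t_{i,i+1}}\,\Phi(Y_i,t_{i,i+1})\in\widehat{\mathfrak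 B_n}$$ by applying $s\mapsto\rho(s)$ for $s\in\mathfrak S_n$ and $t_{ij}\mapsto h\,\rho(t_{ij})$. Let $A\subset\Bbbk[[h]]$ be a subring containing $\Bbbk[h]$ on which the $h$-adic valuation induces the structure of a discrete valuation ring with local parameter $h$ (for instance $A=\Bbbk[[h]]$), and suppose that $R(B_n)\subset GL_N(A)$. Let $K$ be the quotient field of $A$. Let $\mathcal H_\rho=\rho(\mathcal T_n)$ be the Lie subalgebra of $\mathfrak{gl}_N(\Bbbk)$ generated by the $\rho(t_{ij})$, and $\check{\mathcal H}_\rho=\rho(\mathfrak F_n)$ the one generated by $\rho(t_{1n}),\dots,\rho(t_{n-1,n})$. For a subgroup $G$ of $B_n$, let $\mathfrak h(G)\subset\mathfrak{gl}_N(K)$ be the Lie algebra of the Zariski closure of $R(G)$ in $GL_N(K)$. Tensor products are over $\Bbbk$. *Claim.* 1. $\mathcal H_\rho\otimes K\subset\mathfrak h(P_n)$ and $\check{\mathcal H}_\rho\otimes K\subset\mathfrak h(F_n)$. More generally, for every integer $k\neq0$, $\check{\mathcal H}_\rho\otimes K\subset\mathfrak h(G)$ where $G$ is the subgroup generated by $\xi_{1n}^k,\dots,\xi_{n-1,n}^k$.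 2. $\mathcal H_\rho\otimes K\subset\mathfrak h(G)$ for every subgroup $G$ of finite index in $B_n$, and also for every subgroup $G$ of $B_n$ containing $\xi_{ij}^k$ for all $1\le i<j\le n$, for some integer $k\ne0$. 3. For every integer $k\ne0$, if the Lie algebra $\mathcal H_\rho$ is generated by $\rho(t_{12}),\rho(t_{23}),\dots,\rho(t_{n-1,n})$, then $\mathcal H_\rho\otimes K\subset\mathfrak h(C_n^{(k)})$, where $C_n^{(k)}$ is the subgroup generated by $\sigma_1^{2k},\dots,\sigma_{n-1}^{2k}$. -/

import Mathlib

open scoped PowerSeries TensorProduct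

noncomputable section

namespace BraidHull

/-! ### Braid groups -/

/-- The relations of the Artin presentation of the braid group on `n` strands; the generator
with index `i` (`0 ≤ i < n - 1`) crosses the strands `i` and `i + 1`. -/
def braidRels (n : ℕ) : Set (FreeGroup (Fin (n - 1))) :=
  {r | ∃ i j : Fin (n - 1), (i : ℕ) + 1 = j ∧
      r = .of i * .of j * .of i * (.of j * .of i * .of j)⁻¹} ∪
  {r | ∃ i j : Fin (n - 1), (i : ℕ) + 2 ≤ j ∧ r = .of i * .of j * (.of j * .of i)⁻¹}

/-- The braid group `B_n` on `n` strands. -/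
abbrev BraidGroup (n : ℕ) : Type := PresentedGroup (braidRels n)

/-- The left strand of the crossing `i`. -/
def lo {n : ℕ} (i : Fin (n - 1)) : Fin n := ⟨i, by omega⟩

/-- The right strand of the crossing `i`. -/
def hi {n : ℕ} (i : Fin (n - 1)) : Fin n := ⟨i + 1, by omega⟩

/-- The transposition `s_i = (i i+1)`. -/
def transp {n : ℕ} (i : Fin (n - 1)) : Equiv.Perm (Fin n) := Equiv.swap (lo i) (hi i)

/-- The Artin generator `σ_i`, for a natural number `i` with `i + 1 < n`
(and the neutral element outside of this range). -/
def sigma (n i : ℕ) : BraidGroup n :=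
  if h : i < n - 1 then PresentedGroup.of ⟨i, h⟩ else 1

theorem swap_braid {α : Type*} [DecidableEq α] {a b c : α} (hab : a ≠ b) (hac : a ≠ c)
    (hbc : b ≠ c) :
    Equiv.swap a b * Equiv.swap b c * Equiv.swap a b =
      Equiv.swap b c * Equiv.swap a b * Equiv.swap b c := by
  rw [Equiv.swap_mul_swap_mul_swap hab hac]
  rw [Equiv.swap_comm b c, Equiv.swap_comm a b,
    Equiv.swap_mul_swap_mul_swap hbc.symm hac.symm, Equiv.swap_comm]

theorem transp_braid {n : ℕ} {i j : Fin (n - 1)} (h : (i : ℕ) + 1 = j) :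
    transp i * transp j * transp i = transp j * transp i * transp j := by
  have e : lo j = hi i := by ext; simp [lo, hi, h]
  unfold transp
  rw [e]
  apply swap_braid <;> simp only [ne_eq, Fin.ext_iff, lo, hi] <;> omega

theorem transp_comm {n : ℕ} {i j : Fin (n - 1)} (h : (i : ℕ) + 2 ≤ j) :
    transp i * transp j = transp j * transp i := by
  apply Equiv.Perm.Disjoint.commute
  apply Equiv.Perm.disjoint_swap_swap
  simp only [List.nodup_cons, List.mem_cons, Fin.ext_iff, lo, hi]
  simp
  omega

/-- The projection `π : B_n → S_n`, `σ_i ↦ s_i`. -/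
def toPerm (n : ℕ) : BraidGroup n →* Equiv.Perm (Fin n) :=
  PresentedGroup.toGroup (f := transp) (by
    rintro r (⟨i, j, h, rfl⟩ | ⟨i, j, h, rfl⟩)
    · simp only [map_mul, map_inv, FreeGroup.lift_apply_of, mul_inv_eq_one]
      exact transp_braid h
    · simp only [map_mul, map_inv, FreeGroup.lift_apply_of, mul_inv_eq_one]
      exact transp_comm h)

/-- The pure braid group `P_n`. -/
def pureBraidGroup (n : ℕ) : Subgroup (BraidGroup n) := (toPerm n).ker

/-- `xiAux n i d` is
`σ_{i+d} ⋯ σ_{i+1} σ_i² σ_{i+1}⁻¹ ⋯ σ_{i+d}⁻¹`. -/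
def xiAux (n i : ℕ) : ℕ → BraidGroup n
  | 0 => sigma n i ^ 2
  | d + 1 => sigma n (i + d + 1) * xiAux n i d * (sigma n (i + d + 1))⁻¹

/-- The pure braid `ξ_{ij} = σ_{j-1} ⋯ σ_{i+1} σ_i² σ_{i+1}⁻¹ ⋯ σ_{j-1}⁻¹`, for `i < j`. -/
def xi {n : ℕ} (i j : Fin n) : BraidGroup n := xiAux n i ((j : ℕ) - i - 1)

/-- The subgroup generated by the `k`-th powers of the `ξ_{in}`, where `i` runs over all strands
but the last one. For `k = 1` this is the free group `F_n`. -/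
def lastStrandPowers (n : ℕ) (k : ℤ) : Subgroup (BraidGroup n) :=
  Subgroup.closure {b | ∃ i j : Fin n, i < j ∧ (j : ℕ) + 1 = n ∧ b = xi i j ^ k}

/-- The subgroup `F_n` of `P_n`, generated by the `ξ_{in}`, `1 ≤ i ≤ n - 1`. -/
def lastStrandGroup (n : ℕ) : Subgroup (BraidGroup n) :=
  Subgroup.closure {b | ∃ i j : Fin n, i < j ∧ (j : ℕ) + 1 = n ∧ b = xi i j}

/-- The subgroup `C_n^{(k)}` generated by the `σ_i^{2k}`. -/
def rightAngledGroup (n : ℕ) (k : ℤ) : Subgroup (BraidGroup n) :=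
  Subgroup.closure {b | ∃ i : ℕ, i < n - 1 ∧ b = sigma n i ^ (2 * k)}

/-! ### Infinitesimal braids -/

/-- The defining relations of the algebra of infinitesimal pure braids, for a family `t` of
elements of a ring. -/
structure InfBraidRels {E : Type*} [Ring E] {n : ℕ} (t : Fin n → Fin n → E) : Prop where
  symm : ∀ i j, t i j = t j i
  diag : ∀ i, t i i = 0
  comm : ∀ i j l m, i ≠ j → i ≠ l → i ≠ m → j ≠ l → j ≠ m → l ≠ m →
    t i j * t l m = t l m * t i j
  four : ∀ i j l, t i j * (t i l + t l j) = (t i l + t l j) * t i j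

/-- The relations presenting the enveloping algebra `U 𝒯_n`. -/
inductive PureRel (k : Type*) [CommRing k] (n : ℕ) :
    FreeAlgebra k (Fin n × Fin n) → FreeAlgebra k (Fin n × Fin n) → Prop
  | symm (i j) : PureRel k n (.ι k (i, j)) (.ι k (j, i))
  | diag (i) : PureRel k n (.ι k (i, i)) 0
  | comm (i j l m) : i ≠ j → i ≠ l → i ≠ m → j ≠ l → j ≠ m → l ≠ m →
      PureRel k n (.ι k (i, j) * .ι k (l, m)) (.ι k (l, m) * .ι k (i, j))
  | four (i j l) : PureRel k n (.ι k (i, j) * (.ι k (i, l) + .ι k (l, j)))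
      ((.ι k (i, l) + .ι k (l, j)) * .ι k (i, j))

/-- The enveloping algebra `U 𝒯_n` of the Lie algebra of infinitesimal pure braids, as the
associative algebra with the presentation of `𝒯_n`: generators `t_{ij}` and relations
`t_{ij} = t_{ji}`, `t_{ii} = 0`, `[t_{ij}, t_{lm}] = 0` for distinct `i, j, l, m`, and
`[t_{ij}, t_{il} + t_{lj}] = 0`. -/
abbrev InfPureBraid (k : Type*) [CommRing k] (n : ℕ) : Type _ := RingQuot (PureRel k n)

/-- The generator `t_{ij}` of `U 𝒯_n`. -/
def pureT (k : Type*) [CommRing k] {n : ℕ} (i j : Fin n) : InfPureBraid k n :=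
  RingQuot.mkAlgHom k (PureRel k n) (.ι k (i, j))

/-- The relations presenting the algebra of infinitesimal braids. -/
inductive BraidRel (k : Type*) [CommRing k] (n : ℕ) :
    FreeAlgebra k (Equiv.Perm (Fin n) ⊕ Fin n × Fin n) →
      FreeAlgebra k (Equiv.Perm (Fin n) ⊕ Fin n × Fin n) → Prop
  | perm_one : BraidRel k n (.ι k (.inl 1)) 1
  | perm_mul (g g') : BraidRel k n (.ι k (.inl (g * g'))) (.ι k (.inl g) * .ι k (.inl g'))
  | conj (g i j) : BraidRel k n (.ι k (.inl g) * .ι k (.inr (i, j)))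
      (.ι k (.inr (g i, g j)) * .ι k (.inl g))
  | symm (i j) : BraidRel k n (.ι k (.inr (i, j))) (.ι k (.inr (j, i)))
  | diag (i) : BraidRel k n (.ι k (.inr (i, i))) 0
  | comm (i j l m) : i ≠ j → i ≠ l → i ≠ m → j ≠ l → j ≠ m → l ≠ m →
      BraidRel k n (.ι k (.inr (i, j)) * .ι k (.inr (l, m)))
        (.ι k (.inr (l, m)) * .ι k (.inr (i, j)))
  | four (i j l) :
      BraidRel k n (.ι k (.inr (i, j)) * (.ι k (.inr (i, l)) + .ι k (.inr (l, j))))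
        ((.ι k (.inr (i, l)) + .ι k (.inr (l, j))) * .ι k (.inr (i, j)))

/-- The algebra `𝔅_n = k S_n ⋉ U 𝒯_n` of infinitesimal braids, presented by the permutations
(multiplied as in `S_n`) and the `t_{ij}` (with the relations of `𝒯_n`), subject to the
semidirect product relations `g t_{ij} g⁻¹ = t_{g(i) g(j)}`. -/
abbrev InfBraid (k : Type*) [CommRing k] (n : ℕ) : Type _ := RingQuot (BraidRel k n)

section InfBraid

variable (k : Type*) [CommRing k] {n : ℕ}

/-- The generator `t_{ij}` of `𝔅_n`. -/
def braidT (i j : Fin n) : InfBraid k n :=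
  RingQuot.mkAlgHom k (BraidRel k n) (.ι k (.inr (i, j)))

/-- The image of a permutation in `𝔅_n`. -/
def braidS (g : Equiv.Perm (Fin n)) : InfBraid k n :=
  RingQuot.mkAlgHom k (BraidRel k n) (.ι k (.inl g))

/-- The element `Y_r = ∑_{i < r} t_{ir}`. -/
def braidY (r : Fin n) : InfBraid k n :=
  ∑ i ∈ Finset.univ.filter (fun i => i < r), braidT k i r

theorem braidT_rels : InfBraidRels (braidT k (n := n)) where
  symm i j := RingQuot.mkAlgHom_rel k (.symm i j)
  diag i := by simpa [braidT] using RingQuot.mkAlgHom_rel k (BraidRel.diag (k := k) i)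
  comm i j l m h1 h2 h3 h4 h5 h6 := by
    simpa [braidT] using RingQuot.mkAlgHom_rel k (BraidRel.comm (k := k) i j l m h1 h2 h3 h4 h5 h6)
  four i j l := by
    simpa [braidT] using RingQuot.mkAlgHom_rel k (BraidRel.four (k := k) i j l)

theorem braidS_one : braidS k (1 : Equiv.Perm (Fin n)) = 1 := by
  simpa [braidS] using RingQuot.mkAlgHom_rel k (BraidRel.perm_one (k := k) (n := n))

theorem braidS_mul (g g' : Equiv.Perm (Fin n)) :
    braidS k (g * g') = braidS k g * braidS k g' := by
  simpa [braidS] using RingQuot.mkAlgHom_rel k (BraidRel.perm_mul (k := k) g g')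

theorem braidS_conj (g : Equiv.Perm (Fin n)) (i j : Fin n) :
    SemiconjBy (braidS k g) (braidT k i j) (braidT k (g i) (g j)) := by
  simpa [SemiconjBy, braidS, braidT] using RingQuot.mkAlgHom_rel k (BraidRel.conj (k := k) g i j)

end InfBraid

/-- A family satisfying the relations of infinitesimal pure braids defines a morphism out of
`U 𝒯_n`. -/
def pureLift {k : Type*} [CommRing k] {E : Type*} [Ring E] [Algebra k E] {n : ℕ}
    {t : Fin n → Fin n → E} (ht : InfBraidRels t) : InfPureBraid k n →ₐ[k] E :=
  RingQuot.liftAlgHom k ⟨FreeAlgebra.lift k fun p : Fin n × Fin n => t p.1 p.2, by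
    intro x y h
    cases h with
    | symm i j => simpa using ht.symm i j
    | diag i => simpa using ht.diag i
    | comm i j l m h1 h2 h3 h4 h5 h6 => simpa using ht.comm i j l m h1 h2 h3 h4 h5 h6
    | four i j l => simpa using ht.four i j l⟩

theorem pureLift_pureT {k : Type*} [CommRing k] {E : Type*} [Ring E] [Algebra k E] {n : ℕ}
    {t : Fin n → Fin n → E} (ht : InfBraidRels t) (i j : Fin n) :
    pureLift (k := k) ht (pureT k i j) = t i j := by
  simp [pureLift, pureT]

/-! ### Formal series in two non-commuting variables and associators -/

/-- A formal series `Φ(A, B) = ∑_w Φ_w w(A, B)` in two non-commuting variables `A` (letter `0`)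
and `B` (letter `1`), given by its coefficients on words. -/
abbrev NCSeries (k : Type*) : Type _ := List (Fin 2) → k

section Series

variable {k : Type*} [Field k] {E : Type*} [Ring E] [Algebra k E]
  {E' : Type*} [Ring E'] [Algebra k E']

/-- The value `w(a, b)` of a word. -/
def wordEval (a b : E) (w : List (Fin 2)) : E := (w.map ![a, b]).prod

/-- The value `Φ(Xa, Xb)` in `E⟦X⟧`. When `a` and `b` are homogeneous of degree one in a graded
algebra `E`, the coefficient of `X ^ d` is the component of degree `d` of `Φ(a, b)`. So, with the
completion `∏_d E_d` of `E` embedded into `E⟦X⟧` by `(x_d) ↦ ∑_d x_d X ^ d`, this is the element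
`Φ(a, b)` of the completion. -/
def NCSeries.eval (Φ : NCSeries k) (a b : E) : E⟦X⟧ :=
  PowerSeries.mk fun d => ∑ w : List.Vector (Fin 2) d, Φ w.toList • wordEval a b w.toList

/-- The exponential `exp(Xa)` in `E⟦X⟧`; with the same convention, the element `e^a` of the
completion, for `a` homogeneous of degree one. -/
def expX (k : Type*) [Field k] {E : Type*} [Ring E] [Algebra k E] (a : E) : E⟦X⟧ :=
  PowerSeries.mk fun d => ((d.factorial : k))⁻¹ • a ^ d

/-- The variable `A` of the free algebra `k⟨A, B⟩`. -/
abbrev varA (k : Type*) [Field k] : FreeAlgebra k (Fin 2) := FreeAlgebra.ι k 0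

/-- The variable `B` of the free algebra `k⟨A, B⟩`. -/
abbrev varB (k : Type*) [Field k] : FreeAlgebra k (Fin 2) := FreeAlgebra.ι k 1

/-- Drinfeld associators: the set `Assoc_lam(k)`. The group-like equation `Δ(Φ) = Φ ⊗ Φ` is written
in the completion of `k⟨A, B⟩ ⊗ k⟨A, B⟩`, the inversion equation `Φ(B, A) = Φ(A, B)⁻¹` and the
hexagon equation, where `C = -A - B`, in that of `k⟨A, B⟩`, and the pentagon equation in that of
`U 𝒯_4` (whose strands are numbered from `0` to `3`). -/
structure IsAssociator (lam : k) (Φ : NCSeries k) : Prop where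
  grouplike :
    Φ.eval (varA k ⊗ₜ[k] 1 + 1 ⊗ₜ[k] varA k : FreeAlgebra k (Fin 2) ⊗[k] FreeAlgebra k (Fin 2))
        (varB k ⊗ₜ[k] 1 + 1 ⊗ₜ[k] varB k) =
      Φ.eval (varA k ⊗ₜ[k] 1) (varB k ⊗ₜ[k] 1) * Φ.eval (1 ⊗ₜ[k] varA k) (1 ⊗ₜ[k] varB k)
  inv_left : Φ.eval (varB k) (varA k) * Φ.eval (varA k) (varB k) = 1
  inv_right : Φ.eval (varA k) (varB k) * Φ.eval (varB k) (varA k) = 1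
  hexagon :
    expX k (lam • varA k) * Φ.eval (-varA k - varB k) (varA k) *
      expX k (lam • (-varA k - varB k)) * Φ.eval (varB k) (-varA k - varB k) *
      expX k (lam • varB k) * Φ.eval (varA k) (varB k) = 1
  pentagon :
    Φ.eval (pureT k (0 : Fin 4) 1) (pureT k 1 2 + pureT k 1 3) *
        Φ.eval (pureT k 0 2 + pureT k 1 2) (pureT k 2 3) =
      Φ.eval (pureT k (1 : Fin 4) 2) (pureT k 2 3) *
        Φ.eval (pureT k 0 1 + pureT k 0 2) (pureT k 1 3 + pureT k 2 3) *
        Φ.eval (pureT k 0 1) (pureT k 1 2)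

/-! Elementary facts on these series. -/

theorem map_eval (f : E →ₐ[k] E') (Φ : NCSeries k) (a b : E) :
    PowerSeries.map (f : E →+* E') (Φ.eval a b) = Φ.eval (f a) (f b) := by
  ext d
  simp only [NCSeries.eval, PowerSeries.coeff_map, PowerSeries.coeff_mk, map_sum]
  refine Finset.sum_congr rfl fun w _ => ?_
  simp only [RingHom.coe_coe, map_smul, wordEval, map_list_prod, List.map_map]
  congr 3
  funext i
  fin_cases i <;> rfl

theorem map_expX (f : E →ₐ[k] E') (a : E) :
    PowerSeries.map (f : E →+* E') (expX k a) = expX k (f a) := by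
  ext d
  simp [expX]

theorem semiconj_wordEval {z a b a' b' : E} (ha : SemiconjBy z a a') (hb : SemiconjBy z b b')
    (w : List (Fin 2)) : SemiconjBy z (wordEval a b w) (wordEval a' b' w) := by
  induction w with
  | nil => simp [wordEval]
  | cons i w ih =>
    simp only [wordEval, List.map_cons, List.prod_cons] at ih ⊢
    refine SemiconjBy.mul_right ?_ ih
    fin_cases i
    · exact ha
    · exact hb

theorem semiconj_coeff {z : E} {x y : E⟦X⟧}
    (h : ∀ d, SemiconjBy z (PowerSeries.coeff d x) (PowerSeries.coeff d y)) :
    SemiconjBy (PowerSeries.C z) x y := by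
  unfold SemiconjBy
  ext d
  rw [PowerSeries.coeff_C_mul, PowerSeries.coeff_mul_C]
  exact h d

theorem semiconj_smul {z x y : E} (h : SemiconjBy z x y) (c : k) :
    SemiconjBy z (c • x) (c • y) := by
  unfold SemiconjBy at *
  rw [mul_smul_comm, smul_mul_assoc, h]

theorem semiconj_sum {ι : Type*} (s : Finset ι) {z : E} {x y : ι → E}
    (h : ∀ i ∈ s, SemiconjBy z (x i) (y i)) : SemiconjBy z (∑ i ∈ s, x i) (∑ i ∈ s, y i) := by
  unfold SemiconjBy at *
  rw [Finset.mul_sum, Finset.sum_mul]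
  exact Finset.sum_congr rfl h

theorem semiconj_coeff_eval {z a b a' b' : E} (ha : SemiconjBy z a a') (hb : SemiconjBy z b b')
    (Φ : NCSeries k) (d : ℕ) :
    SemiconjBy z (PowerSeries.coeff d (Φ.eval a b)) (PowerSeries.coeff d (Φ.eval a' b')) := by
  simp only [NCSeries.eval, PowerSeries.coeff_mk]
  exact semiconj_sum _ fun w _ => semiconj_smul (semiconj_wordEval ha hb _) _

theorem semiconj_coeff_expX {z a a' : E} (ha : SemiconjBy z a a') (d : ℕ) :
    SemiconjBy z (PowerSeries.coeff d (expX k a)) (PowerSeries.coeff d (expX k a')) := by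
  simp only [expX, PowerSeries.coeff_mk]
  exact semiconj_smul (ha.pow_right d) _

theorem semiconj_eval {z a b a' b' : E} (ha : SemiconjBy z a a') (hb : SemiconjBy z b b')
    (Φ : NCSeries k) : SemiconjBy (PowerSeries.C z) (Φ.eval a b) (Φ.eval a' b') :=
  semiconj_coeff fun d => semiconj_coeff_eval ha hb Φ d

theorem semiconj_expX {z a a' : E} (ha : SemiconjBy z a a') :
    SemiconjBy (PowerSeries.C z) (expX k a) (expX k a') :=
  semiconj_coeff fun d => semiconj_coeff_expX ha d

theorem commute_of_coeff {x y : E⟦X⟧}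
    (h : ∀ d e, Commute (PowerSeries.coeff d x) (PowerSeries.coeff e y)) : Commute x y := by
  unfold Commute SemiconjBy
  ext d
  rw [PowerSeries.coeff_mul, PowerSeries.coeff_mul,
    ← Finset.Nat.sum_antidiagonal_swap (n := d)]
  exact Finset.sum_congr rfl fun p _ => h _ _

theorem commute_eval_eval {a b c d : E} (Φ Ψ : NCSeries k) (h1 : Commute a c) (h2 : Commute a d)
    (h3 : Commute b c) (h4 : Commute b d) : Commute (Φ.eval a b) (Ψ.eval c d) := by
  refine commute_of_coeff fun i j => ?_
  refine semiconj_coeff_eval ?_ ?_ Ψ j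
  · exact Commute.symm (semiconj_coeff_eval h1.symm h3.symm Φ i)
  · exact Commute.symm (semiconj_coeff_eval h2.symm h4.symm Φ i)

theorem commute_eval_expX {a b c : E} (Φ : NCSeries k) (h1 : Commute a c) (h2 : Commute b c) :
    Commute (Φ.eval a b) (expX k c) := by
  refine commute_of_coeff fun i j => ?_
  exact semiconj_coeff_expX (Commute.symm (semiconj_coeff_eval h1.symm h2.symm Φ i)) j

theorem commute_expX_expX {a c : E} (h : Commute a c) : Commute (expX k a) (expX k c) := by
  refine commute_of_coeff fun i j => ?_
  exact semiconj_coeff_expX (Commute.symm (semiconj_coeff_expX h.symm i)) j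

theorem expX_zero : expX k (0 : E) = 1 := by
  ext d
  simp only [expX, PowerSeries.coeff_mk, PowerSeries.coeff_one]
  cases d with
  | zero => simp
  | succ d => simp

theorem expX_add [CharZero k] {a b : E} (h : Commute a b) :
    expX k (a + b) = expX k a * expX k b := by
  ext d
  simp only [expX, PowerSeries.coeff_mk, PowerSeries.coeff_mul, h.add_pow', Finset.smul_sum]
  refine Finset.sum_congr rfl fun p hp => ?_
  rw [smul_mul_smul_comm, ← Nat.cast_smul_eq_nsmul k, smul_smul]
  congr 1
  rw [← Finset.HasAntidiagonal.mem_antidiagonal.mp hp, Nat.choose_symm_add, Nat.add_choose,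
    Nat.cast_div (Nat.factorial_mul_factorial_dvd_factorial_add _ _)
      (by exact_mod_cast mul_ne_zero (Nat.factorial_ne_zero _) (Nat.factorial_ne_zero _))]
  have h1 : (((p.1 + p.2).factorial : k)) ≠ 0 := by exact_mod_cast Nat.factorial_ne_zero _
  have h2 : ((p.1.factorial : k)) ≠ 0 := by exact_mod_cast Nat.factorial_ne_zero _
  have h3 : ((p.2.factorial : k)) ≠ 0 := by exact_mod_cast Nat.factorial_ne_zero _
  push_cast
  field_simp

theorem eval_zero_zero (Φ : NCSeries k) :
    Φ.eval (0 : E) 0 = PowerSeries.C (algebraMap k E (Φ [])) := by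
  ext d
  simp only [NCSeries.eval, PowerSeries.coeff_mk, PowerSeries.coeff_C]
  cases d with
  | zero =>
    rw [if_pos rfl, Fintype.sum_eq_single List.Vector.nil
      (fun w hw => absurd (Subsingleton.elim w _) hw)]
    simp [wordEval, Algebra.algebraMap_eq_smul_one]
  | succ d =>
    rw [if_neg (Nat.succ_ne_zero d)]
    refine Finset.sum_eq_zero fun w _ => ?_
    have : wordEval (0 : E) 0 w.toList = 0 := by
      rw [wordEval]
      apply List.prod_eq_zero
      rw [List.mem_map]
      refine ⟨w.head, ?_, ?_⟩
      · rw [← List.Vector.cons_head_tail w]; simp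
      · generalize w.head = c
        fin_cases c <;> rfl
    rw [this, smul_zero]

end Series

section Associator

variable {k : Type*} [Field k] {lam : k} {Φ : NCSeries k} {E : Type*} [Ring E] [Algebra k E]

theorem IsAssociator.mul_swap (hΦ : IsAssociator lam Φ) (a b : E) :
    Φ.eval b a * Φ.eval a b = 1 := by
  have h := congrArg (PowerSeries.map (FreeAlgebra.lift k ![a, b] : _ →ₐ[k] E).toRingHom)
    hΦ.inv_left
  simp only [AlgHom.toRingHom_eq_coe, map_mul, map_eval, map_one] at h
  simpa using h

theorem IsAssociator.hexagon' (hΦ : IsAssociator lam Φ) (a b : E) :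
    expX k (lam • a) * Φ.eval (-a - b) a * expX k (lam • (-a - b)) * Φ.eval b (-a - b) *
      expX k (lam • b) * Φ.eval a b = 1 := by
  have h := congrArg (PowerSeries.map (FreeAlgebra.lift k ![a, b] : _ →ₐ[k] E).toRingHom)
    hΦ.hexagon
  simp only [AlgHom.toRingHom_eq_coe, map_mul, map_eval, map_expX, map_one] at h
  simpa using h

theorem IsAssociator.pentagon' (hΦ : IsAssociator lam Φ) {t : Fin 4 → Fin 4 → E}
    (ht : InfBraidRels t) :
    Φ.eval (t 0 1) (t 1 2 + t 1 3) * Φ.eval (t 0 2 + t 1 2) (t 2 3) =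
      Φ.eval (t 1 2) (t 2 3) * Φ.eval (t 0 1 + t 0 2) (t 1 3 + t 2 3) * Φ.eval (t 0 1) (t 1 2) := by
  have h := congrArg (PowerSeries.map (pureLift (k := k) ht).toRingHom) hΦ.pentagon
  simpa only [AlgHom.toRingHom_eq_coe, map_mul, map_eval, map_add, pureLift_pureT] using h

theorem commute_freeLift {a b z w : E} (h1 : Commute a z) (h2 : Commute a w) (h3 : Commute b z)
    (h4 : Commute b w) (x y : FreeAlgebra k (Fin 2)) :
    Commute (FreeAlgebra.lift k ![a, b] x) (FreeAlgebra.lift k ![z, w] y) := by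
  have key : ∀ (c : E), Commute a c → Commute b c → ∀ x : FreeAlgebra k (Fin 2),
      Commute (FreeAlgebra.lift k ![a, b] x) c := by
    intro c ha hb x
    induction x using FreeAlgebra.induction with
    | grade0 r => rw [AlgHom.commutes]; exact Algebra.commutes r c
    | grade1 i => fin_cases i <;> simpa
    | mul x y hx hy => simpa using hx.mul_left hy
    | add x y hx hy => simpa using hx.add_left hy
  have key' : ∀ (c : E), Commute z c → Commute w c → ∀ x : FreeAlgebra k (Fin 2),
      Commute (FreeAlgebra.lift k ![z, w] x) c := by
    intro c ha hb x
    induction x using FreeAlgebra.induction with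
    | grade0 r => rw [AlgHom.commutes]; exact Algebra.commutes r c
    | grade1 i => fin_cases i <;> simpa
    | mul x y hx hy => simpa using hx.mul_left hy
    | add x y hx hy => simpa using hx.add_left hy
  exact key _ (key' a h1.symm h2.symm y).symm (key' b h3.symm h4.symm y).symm x

theorem IsAssociator.grouplike' (hΦ : IsAssociator lam Φ) {a b z w : E} (h1 : Commute a z)
    (h2 : Commute a w) (h3 : Commute b z) (h4 : Commute b w) :
    Φ.eval (a + z) (b + w) = Φ.eval a b * Φ.eval z w := by
  have h := congrArg (PowerSeries.map (Algebra.TensorProduct.lift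
    (FreeAlgebra.lift k ![a, b] : _ →ₐ[k] E) (FreeAlgebra.lift k ![z, w])
    (commute_freeLift h1 h2 h3 h4)).toRingHom) hΦ.grouplike
  simp only [AlgHom.toRingHom_eq_coe, map_mul, map_eval] at h
  simpa using h

theorem IsAssociator.eval_zero (hΦ : IsAssociator lam Φ) : Φ.eval (0 : E) 0 = 1 := by
  have h1 : Φ.eval (0 : E) 0 = Φ.eval (0 : E) 0 * Φ.eval (0 : E) 0 := by
    simpa using hΦ.grouplike' (a := (0 : E)) (b := 0) (z := 0) (w := 0) (Commute.zero_left _)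
      (Commute.zero_left _) (Commute.zero_left _) (Commute.zero_left _)
  rw [h1]; exact hΦ.mul_swap 0 0

theorem infBraidRels_single (i₀ j₀ : Fin 4) (h₀ : i₀ ≠ j₀) (z : E) :
    InfBraidRels fun i j : Fin 4 =>
      if (i = i₀ ∧ j = j₀) ∨ (i = j₀ ∧ j = i₀) then z else 0 where
  symm i j := by congr 1; simp only [eq_iff_iff]; tauto
  diag i := by
    rw [if_neg]; rintro (⟨rfl, h⟩ | ⟨rfl, h⟩)
    · exact h₀ h
    · exact h₀ h.symm
  comm i j l m _ _ _ _ _ _ := by split_ifs <;> first | rfl | simp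
  four i j l := by split_ifs <;> first | rfl | simp [mul_add, add_mul]

theorem IsAssociator.eval_right_zero (hΦ : IsAssociator lam Φ) (z : E) : Φ.eval z 0 = 1 := by
  have h := hΦ.pentagon' (infBraidRels_single 0 1 (by decide) z)
  simp [hΦ.eval_zero] at h
  calc Φ.eval z 0 = (Φ.eval 0 z * Φ.eval z 0) * Φ.eval z 0 := by rw [hΦ.mul_swap, one_mul]
    _ = 1 := by rw [mul_assoc, ← h, hΦ.mul_swap]

theorem IsAssociator.eval_left_zero (hΦ : IsAssociator lam Φ) (z : E) : Φ.eval 0 z = 1 := by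
  have h := hΦ.mul_swap z 0
  rwa [hΦ.eval_right_zero, mul_one] at h

theorem IsAssociator.eval_add_left (hΦ : IsAssociator lam Φ) {a b z : E} (ha : Commute a z)
    (hb : Commute b z) : Φ.eval (a + z) b = Φ.eval a b := by
  have h := hΦ.grouplike' ha (Commute.zero_right a) hb (Commute.zero_right b)
  rwa [hΦ.eval_right_zero, mul_one, add_zero] at h

theorem IsAssociator.eval_add_right (hΦ : IsAssociator lam Φ) {a b z : E} (ha : Commute a z)
    (hb : Commute b z) : Φ.eval a (b + z) = Φ.eval a b := by
  have h := hΦ.grouplike' (Commute.zero_right a) ha (Commute.zero_right b) hb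
  rwa [hΦ.eval_left_zero, mul_one, add_zero] at h

theorem IsAssociator.hexagon_central [CharZero k] (hΦ : IsAssociator lam Φ) {a b c z : E}
    (hz : a + b + c = z) (ha : Commute a z) (hb : Commute b z) :
    expX k (lam • a) * Φ.eval c a * expX k (lam • c) * Φ.eval b c * expX k (lam • b) *
      Φ.eval a b = expX k (lam • z) := by
  have hc : c = (-a - b) + z := by rw [← hz]; abel
  have hd : Commute (-a - b) z := (ha.neg_left).sub_left hb
  have e1 : Φ.eval c a = Φ.eval (-a - b) a := by rw [hc, hΦ.eval_add_left hd ha]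
  have e2 : Φ.eval b c = Φ.eval b (-a - b) := by rw [hc, hΦ.eval_add_right hb hd]
  have e3 : expX k (lam • c) = expX k (lam • (-a - b)) * expX k (lam • z) := by
    rw [hc, smul_add, expX_add ((hd.smul_left lam).smul_right lam)]
  have c1 : Commute (Φ.eval b (-a - b)) (expX k (lam • z)) :=
    commute_eval_expX Φ (hb.smul_right lam) (hd.smul_right lam)
  have c2 : Commute (expX k (lam • b)) (expX k (lam • z)) :=
    commute_expX_expX ((hb.smul_right lam).smul_left lam)
  have c3 : Commute (Φ.eval a b) (expX k (lam • z)) :=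
    commute_eval_expX Φ (ha.smul_right lam) (hb.smul_right lam)
  have h := hΦ.hexagon' a b
  rw [e1, e2, e3]
  calc _ = expX k (lam • a) * Φ.eval (-a - b) a * expX k (lam • (-a - b)) *
        (expX k (lam • z) * (Φ.eval b (-a - b) * expX k (lam • b) * Φ.eval a b)) := by
        simp only [mul_assoc]
    _ = expX k (lam • a) * Φ.eval (-a - b) a * expX k (lam • (-a - b)) * Φ.eval b (-a - b) *
        expX k (lam • b) * Φ.eval a b * expX k (lam • z) := by
        rw [← ((c1.mul_left c2).mul_left c3).eq]; simp only [mul_assoc]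
    _ = expX k (lam • z) := by rw [h, one_mul]

/-- The braid relation on three strands. -/
theorem IsAssociator.braid_three [CharZero k] (hΦ : IsAssociator lam Φ) {a b c p q : E}
    (ha : Commute a (a + b + c)) (hb : Commute b (a + b + c))
    (hp : SemiconjBy p a a) (hpb : SemiconjBy p b c) (hpc : SemiconjBy p c b)
    (hq : SemiconjBy q b b) (hqa : SemiconjBy q a c) (hqc : SemiconjBy q c a)
    (hpq : p * q * p = q * p * q) :
    let u := Φ.eval a b * PowerSeries.C p * expX k (lam • a) * Φ.eval b a
    let v := PowerSeries.C q * expX k (lam • b)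
    u * v * u = v * u * v := by
  intro u v
  set P : E⟦X⟧ := PowerSeries.C p
  set Q : E⟦X⟧ := PowerSeries.C q
  set W := expX k (lam • (a + b + c))
  have hPQ : P * Q * P = Q * P * Q := by
    simp only [P, Q, ← map_mul, hpq]
  have x1 : Φ.eval b a * Q = Q * Φ.eval b c := ((semiconj_eval hq hqc Φ)).eq.symm
  have x2 : expX k (lam • a) * Q = Q * expX k (lam • c) :=
    (semiconj_expX (semiconj_smul hqc lam)).eq.symm
  have x3 : Φ.eval a b * P = P * Φ.eval a c := ((semiconj_eval hp hpc Φ)).eq.symm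
  have x4 : expX k (lam • b) * P = P * expX k (lam • c) :=
    (semiconj_expX (semiconj_smul hpc lam)).eq.symm
  have x5 : Φ.eval a c * Q = Q * Φ.eval c a := ((semiconj_eval hqc hqa Φ)).eq.symm
  have x6 : Φ.eval b c * P = P * Φ.eval c b := ((semiconj_eval hpc hpb Φ)).eq.symm
  have x7 : expX k (lam • c) * P = P * expX k (lam • b) :=
    (semiconj_expX (semiconj_smul hpb lam)).eq.symm
  have x8 : Φ.eval c a * P = P * Φ.eval b a := ((semiconj_eval hpb hp Φ)).eq.symm
  have h1 : expX k (lam • a) * Φ.eval c a * expX k (lam • c) * Φ.eval b c * expX k (lam • b) *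
      Φ.eval a b = W := hΦ.hexagon_central rfl ha hb
  have h2 : expX k (lam • b) * Φ.eval c b * expX k (lam • c) * Φ.eval a c * expX k (lam • a) *
      Φ.eval b a = W := hΦ.hexagon_central (by abel) hb ha
  have cW : Commute (Φ.eval b a) W :=
    commute_eval_expX Φ (hb.smul_right lam) (ha.smul_right lam)
  have hv : v * u * v = Q * P * Q * W * Φ.eval b a := by
    calc v * u * v = Q * expX k (lam • b) * (Φ.eval a b * P) * expX k (lam • a) *
          (Φ.eval b a * Q) * expX k (lam • b) := by simp only [u, v, P, Q, mul_assoc]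
      _ = Q * (expX k (lam • b) * P) * Φ.eval a c * (expX k (lam • a) * Q) * Φ.eval b c *
          expX k (lam • b) := by rw [x1, x3]; simp only [mul_assoc]
      _ = Q * P * expX k (lam • c) * (Φ.eval a c * Q) * expX k (lam • c) * Φ.eval b c *
          expX k (lam • b) := by rw [x2, x4]; simp only [mul_assoc]
      _ = Q * P * (expX k (lam • c) * Q) * Φ.eval c a * expX k (lam • c) * Φ.eval b c *
          expX k (lam • b) := by rw [x5]; simp only [mul_assoc]
      _ = Q * P * Q * (expX k (lam • a) * Φ.eval c a * expX k (lam • c) * Φ.eval b c *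
          expX k (lam • b) * (Φ.eval a b * Φ.eval b a)) := by
          rw [(semiconj_expX (semiconj_smul hqa lam)).eq.symm, hΦ.mul_swap, mul_one]
          simp only [mul_assoc, Q]
      _ = Q * P * Q * W * Φ.eval b a := by rw [← h1]; simp only [mul_assoc]
  have hu : u * v * u = P * Q * P * W * Φ.eval b a := by
    calc u * v * u = Φ.eval a b * P * expX k (lam • a) * (Φ.eval b a * Q) * expX k (lam • b) *
          (Φ.eval a b * P) * expX k (lam • a) * Φ.eval b a := by
          simp only [u, v, P, Q, mul_assoc]
      _ = Φ.eval a b * P * (expX k (lam • a) * Q) * Φ.eval b c * (expX k (lam • b) *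
          P) * Φ.eval a c * expX k (lam • a) * Φ.eval b a := by
          rw [x1, x3]; simp only [mul_assoc]
      _ = Φ.eval a b * P * Q * expX k (lam • c) * (Φ.eval b c * P) * expX k (lam • c) *
          Φ.eval a c * expX k (lam • a) * Φ.eval b a := by
          rw [x2, x4]; simp only [mul_assoc]
      _ = (Φ.eval a b * P) * Q * (expX k (lam • c) * P) * Φ.eval c b * expX k (lam • c) *
          Φ.eval a c * expX k (lam • a) * Φ.eval b a := by
          rw [x6]; simp only [mul_assoc]
      _ = P * (Φ.eval a c * Q) * P * (expX k (lam • b) * Φ.eval c b * expX k (lam • c) *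
          Φ.eval a c * expX k (lam • a) * Φ.eval b a) := by
          rw [x3, x7]; simp only [mul_assoc]
      _ = P * Q * (Φ.eval c a * P) * W := by rw [x5, h2]; simp only [mul_assoc]
      _ = P * Q * P * W * Φ.eval b a := by
          rw [x8, ← mul_assoc (P * Q), mul_assoc (P * Q * P), cW.eq, ← mul_assoc]
  rw [hu, hv, hPQ]

/-- The element `Φ(t, y) s e^{lam t} Φ(y, t)`. -/
def braidElt (lam : k) (Φ : NCSeries k) (s t y : E) : E⟦X⟧ :=
  Φ.eval t y * PowerSeries.C s * expX k (lam • t) * Φ.eval y t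

/-- The braid relation for two consecutive generators. -/
theorem IsAssociator.braid_four [CharZero k] (hΦ : IsAssociator lam Φ) {t : Fin 4 → Fin 4 → E}
    (ht : InfBraidRels t) {p q : E} (hpq : p * q * p = q * p * q)
    (p12 : SemiconjBy p (t 0 1) (t 0 2)) (p21 : SemiconjBy p (t 0 2) (t 0 1))
    (p23 : SemiconjBy p (t 1 2) (t 1 2))
    (p24 : SemiconjBy p (t 1 3) (t 2 3)) (p34 : SemiconjBy p (t 2 3) (t 1 3))
    (q12 : SemiconjBy q (t 0 1) (t 0 1))
    (q34 : SemiconjBy q (t 2 3) (t 2 3)) (q23 : SemiconjBy q (t 1 2) (t 1 3))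
    (q24 : SemiconjBy q (t 1 3) (t 1 2)) :
    let x := braidElt lam Φ p (t 1 2) (t 0 1)
    let y := braidElt lam Φ q (t 2 3) (t 0 2 + t 1 2)
    x * y * x = y * x * y := by
  intro x y
  set P : E⟦X⟧ := PowerSeries.C p
  set Q : E⟦X⟧ := PowerSeries.C q
  set S := expX k (lam • t 1 2)
  set T := expX k (lam • t 2 3)
  set a := Φ.eval (t 0 1) (t 1 2)
  set a' := Φ.eval (t 1 2) (t 0 1)
  set b := Φ.eval (t 0 2 + t 1 2) (t 2 3)
  set b' := Φ.eval (t 2 3) (t 0 2 + t 1 2)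
  set c := Φ.eval (t 0 1) (t 1 2 + t 1 3)
  set d := Φ.eval (t 0 1 + t 0 2) (t 1 3 + t 2 3)
  set e := Φ.eval (t 1 2) (t 2 3)
  set e' := Φ.eval (t 2 3) (t 1 2)
  have pent : c * b = e * d * a := hΦ.pentagon' ht
  have aa : a * a' = 1 := hΦ.mul_swap _ _
  have bb : b * b' = 1 := hΦ.mul_swap _ _
  have ee : e' * e = 1 := hΦ.mul_swap _ _
  have four (i j l : Fin 4) : Commute (t i j) (t i l + t l j) := ht.four i j l
  have dP : Commute d P := by
    refine Commute.symm ?_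
    have h := semiconj_eval (k := k) (p12.add_right p21) (p24.add_right p34) Φ
    rwa [add_comm (t 0 2), add_comm (t 2 3)] at h
  have dS : Commute d S := by
    refine commute_eval_expX Φ (Commute.smul_right (Commute.symm ?_) lam)
      (Commute.smul_right (Commute.symm ?_) lam)
    · have := four 1 2 0
      rwa [ht.symm 1 0] at this
    · have := four 1 2 3
      rwa [ht.symm 3 2] at this
  have cQ : Commute c Q := by
    refine Commute.symm ?_
    have h := semiconj_eval (k := k) q12 (q23.add_right q24) Φ
    rwa [add_comm (t 1 3)] at h
  have cT : Commute c T := by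
    refine commute_eval_expX Φ (Commute.smul_right ?_ lam)
      (Commute.smul_right (Commute.symm ?_) lam)
    · exact ht.comm 0 1 2 3 (by decide) (by decide) (by decide) (by decide) (by decide)
        (by decide)
    · have := four 2 3 1
      rwa [ht.symm 2 1] at this
  have hx : (c * b) * x = e * P * S * e' * (c * b) := by
    calc (c * b) * x = e * d * (a * a') * P * S * a := by
          rw [pent]; simp only [x, braidElt, mul_assoc, a, a', P, S]
      _ = e * (d * (P * S)) * a := by rw [aa, mul_one]; simp only [mul_assoc]
      _ = e * P * S * (e' * e) * d * a := by
          rw [(dP.mul_right dS).eq, ee, mul_one]; simp only [mul_assoc]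
      _ = e * P * S * e' * (c * b) := by rw [pent]; simp only [mul_assoc]
  have hy : (c * b) * y = Q * T * (c * b) := by
    calc (c * b) * y = c * (b * b') * (Q * T) * b := by
          simp only [y, braidElt, mul_assoc, b, b', Q, T]
      _ = c * (Q * T) * b := by rw [bb, mul_one]
      _ = Q * T * (c * b) := by rw [(cQ.mul_right cT).eq]; simp only [mul_assoc]
  have h3 : (e * P * S * e') * (Q * T) * (e * P * S * e') =
      (Q * T) * (e * P * S * e') * (Q * T) := by
    refine hΦ.braid_three (c := t 1 3) ?_ ?_ p23 p34 p24 q34 q23 q24 hpq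
    · have := four 1 2 3
      rw [ht.symm 3 2] at this
      have h := (Commute.refl (t 1 2)).add_right this
      rwa [add_comm (t 1 3), ← add_assoc] at h
    · have := four 2 3 1
      rw [ht.symm 2 1] at this
      have h := (Commute.refl (t 2 3)).add_right this
      rwa [← add_assoc, add_comm (t 2 3)] at h
  have hxyx : (c * b) * (x * y * x) = (c * b) * (y * x * y) := by
    calc (c * b) * (x * y * x) = (c * b) * x * y * x := by simp only [mul_assoc]
      _ = e * P * S * e' * ((c * b) * y) * x := by rw [hx]; simp only [mul_assoc]
      _ = e * P * S * e' * (Q * T) * ((c * b) * x) := by rw [hy]; simp only [mul_assoc]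
      _ = (e * P * S * e') * (Q * T) * (e * P * S * e') * (c * b) := by
          rw [hx]; simp only [mul_assoc]
      _ = Q * T * (e * P * S * e') * (Q * T * (c * b)) := by rw [h3]; simp only [mul_assoc]
      _ = Q * T * ((e * P * S * e') * (c * b)) * y := by rw [← hy]; simp only [mul_assoc]
      _ = (Q * T * (c * b)) * x * y := by rw [← hx]; simp only [mul_assoc]
      _ = (c * b) * (y * x * y) := by rw [← hy]; simp only [mul_assoc]
  have cc : Φ.eval (t 1 2 + t 1 3) (t 0 1) * c = 1 := hΦ.mul_swap _ _
  have bb' : b' * b = 1 := hΦ.mul_swap _ _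
  have inv : b' * Φ.eval (t 1 2 + t 1 3) (t 0 1) * (c * b) = 1 := by
    calc _ = b' * (Φ.eval (t 1 2 + t 1 3) (t 0 1) * c) * b := by simp only [mul_assoc]
      _ = 1 := by rw [cc, mul_one, bb']
  calc x * y * x = b' * Φ.eval (t 1 2 + t 1 3) (t 0 1) * ((c * b) * (x * y * x)) := by
        rw [← mul_assoc, inv, one_mul]
    _ = y * x * y := by rw [hxyx, ← mul_assoc, inv, one_mul]

theorem IsAssociator.braidElt_mul_inv [CharZero k] (hΦ : IsAssociator lam Φ) {s t y : E}
    (hs : s * s = 1) :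
    braidElt lam Φ s t y * (Φ.eval t y * expX k (lam • -t) * PowerSeries.C s * Φ.eval y t) = 1 := by
  have h1 : expX k (lam • t) * expX k (lam • -t) = 1 := by
    rw [← expX_add (by simp [Commute.refl])]; simp [expX_zero]
  have h2 : (PowerSeries.C s : E⟦X⟧) * PowerSeries.C s = 1 := by rw [← map_mul, hs, map_one]
  calc _ = Φ.eval t y * PowerSeries.C s * expX k (lam • t) * (Φ.eval y t * Φ.eval t y) *
        expX k (lam • -t) * PowerSeries.C s * Φ.eval y t := by simp only [braidElt, mul_assoc]
    _ = Φ.eval t y * PowerSeries.C s * (expX k (lam • t) *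
        expX k (lam • -t)) * PowerSeries.C s * Φ.eval y t := by
        rw [hΦ.mul_swap, mul_one]; simp only [mul_assoc]
    _ = Φ.eval t y * (PowerSeries.C s * PowerSeries.C s) * Φ.eval y t := by
        rw [h1, mul_one]; simp only [mul_assoc]
    _ = 1 := by rw [h2, mul_one, hΦ.mul_swap]

theorem IsAssociator.inv_mul_braidElt [CharZero k] (hΦ : IsAssociator lam Φ) {s t y : E}
    (hs : s * s = 1) :
    (Φ.eval t y * expX k (lam • -t) * PowerSeries.C s * Φ.eval y t) * braidElt lam Φ s t y = 1 := by
  have h1 : expX k (lam • -t) * expX k (lam • t) = 1 := by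
    rw [← expX_add (by simp [Commute.refl])]; simp [expX_zero]
  have h2 : (PowerSeries.C s : E⟦X⟧) * PowerSeries.C s = 1 := by rw [← map_mul, hs, map_one]
  calc _ = Φ.eval t y * expX k (lam • -t) * PowerSeries.C s * (Φ.eval y t * Φ.eval t y) *
        PowerSeries.C s * expX k (lam • t) * Φ.eval y t := by simp only [braidElt, mul_assoc]
    _ = Φ.eval t y * expX k (lam • -t) * (PowerSeries.C s * PowerSeries.C s) *
        expX k (lam • t) * Φ.eval y t := by rw [hΦ.mul_swap, mul_one]; simp only [mul_assoc]
    _ = Φ.eval t y * (expX k (lam • -t) * expX k (lam • t)) * Φ.eval y t := by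
        rw [h2, mul_one]; simp only [mul_assoc]
    _ = 1 := by rw [h1, mul_one, hΦ.mul_swap]

theorem commute_braidElt {s t y s' t' y' : E} (h1 : Commute s s') (h2 : Commute s t')
    (h3 : Commute s y') (h4 : Commute t s') (h5 : Commute t t') (h6 : Commute t y')
    (h7 : Commute y s') (h8 : Commute y t') (h9 : Commute y y') :
    Commute (braidElt lam Φ s t y) (braidElt lam Φ s' t' y') := by
  have hC : Commute (PowerSeries.C s : E⟦X⟧) (PowerSeries.C s') := by
    unfold Commute SemiconjBy
    rw [← map_mul, ← map_mul, h1.eq]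
  have key : ∀ x : E⟦X⟧, Commute (PowerSeries.C s) x → Commute (Φ.eval t y) x →
      Commute (expX k (lam • t)) x → Commute (Φ.eval y t) x → Commute (braidElt lam Φ s t y) x :=
    fun x a b c d => ((b.mul_left a).mul_left c).mul_left d
  refine Commute.mul_right (Commute.mul_right (Commute.mul_right ?_ ?_) ?_) ?_
  · exact key _ (semiconj_eval h2 h3 Φ) (commute_eval_eval Φ Φ h5 h6 h8 h9)
      (Commute.symm (commute_eval_expX Φ (h5.symm.smul_right lam) (h6.symm.smul_right lam)))
      (commute_eval_eval Φ Φ h8 h9 h5 h6)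
  · exact key _ hC (Commute.symm (semiconj_eval h4.symm h7.symm Φ))
      (Commute.symm (semiconj_expX (h4.symm.smul_right lam)))
      (Commute.symm (semiconj_eval h7.symm h4.symm Φ))
  · exact key _ (semiconj_expX (h2.smul_right lam))
      (commute_eval_expX Φ (h5.smul_right lam) (h8.smul_right lam))
      (commute_expX_expX ((h5.smul_right lam).smul_left lam))
      (commute_eval_expX Φ (h8.smul_right lam) (h5.smul_right lam))
  · exact key _ (semiconj_eval h3 h2 Φ) (commute_eval_eval Φ Φ h6 h5 h9 h8)
      (Commute.symm (commute_eval_expX Φ (h6.symm.smul_right lam) (h5.symm.smul_right lam)))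
      (commute_eval_eval Φ Φ h9 h8 h6 h5)

end Associator

/-! ### The Drinfeld morphism -/

section Cabling

variable {E : Type*} [Ring E] {n m : ℕ}

/-- Replacing strands by disjoint groups of parallel strands. -/
def cable (t : Fin n → Fin n → E) (S : Fin m → Finset (Fin n)) (a b : Fin m) : E :=
  if a = b then 0 else ∑ p ∈ S a, ∑ q ∈ S b, t p q

theorem cable_rels {t : Fin n → Fin n → E} (ht : InfBraidRels t) {S : Fin m → Finset (Fin n)}
    (hS : ∀ a b, a ≠ b → Disjoint (S a) (S b)) : InfBraidRels (cable t S) where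
  symm a b := by
    unfold cable
    rw [Finset.sum_comm]
    simp only [eq_comm (a := a), ht.symm]
  diag a := by simp [cable]
  comm a b c d h1 h2 h3 h4 h5 h6 := by
    simp only [cable, if_neg h1, if_neg h6]
    have ne {x y : Fin m} (h : x ≠ y) {p q : Fin n} (hp : p ∈ S x) (hq : q ∈ S y) : p ≠ q :=
      fun e => Finset.disjoint_left.mp (hS x y h) hp (e ▸ hq)
    refine Commute.sum_left _ _ _ fun p hp => Commute.sum_left _ _ _ fun q hq =>
      Commute.sum_right _ _ _ fun r hr => Commute.sum_right _ _ _ fun s hs => ?_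
    exact ht.comm p q r s (ne h1 hp hq) (ne h2 hp hr) (ne h3 hp hs) (ne h4 hq hr) (ne h5 hq hs)
      (ne h6 hr hs)
  four a b c := by
    have ne {x y : Fin m} (h : x ≠ y) {p q : Fin n} (hp : p ∈ S x) (hq : q ∈ S y) : p ≠ q :=
      fun e => Finset.disjoint_left.mp (hS x y h) hp (e ▸ hq)
    by_cases hab : a = b
    · simp [cable, hab]
    by_cases hac : a = c
    · subst hac; simp [cable]
    by_cases hcb : c = b
    · subst hcb; simp [cable]
    simp only [cable, if_neg hab, if_neg hac, if_neg hcb]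
    refine Commute.sum_left _ _ _ fun p hp => Commute.sum_left _ _ _ fun q hq => ?_
    rw [Finset.sum_comm (s := S a), ← Finset.sum_add_distrib]
    refine Commute.sum_right _ _ _ fun r hr => ?_
    rw [← Finset.add_sum_erase _ _ hp, ← Finset.add_sum_erase _ _ hq, add_add_add_comm]
    refine Commute.add_right (ht.four p q r) (Commute.add_right ?_ ?_)
    · refine Commute.sum_right _ _ _ fun p' hp' => ?_
      rw [Finset.mem_erase] at hp'
      exact ht.comm p q p' r (ne hab hp hq) hp'.1.symm (ne hac hp hr)
        (ne (Ne.symm hab) hq hp'.2) (ne (Ne.symm hcb) hq hr) (ne hac hp'.2 hr)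
    · refine Commute.sum_right _ _ _ fun q' hq' => ?_
      rw [Finset.mem_erase] at hq'
      exact ht.comm p q r q' (ne hab hp hq) (ne hac hp hr) (ne hab hp hq'.2)
        (ne (Ne.symm hcb) hq hr) hq'.1.symm (ne hcb hr hq'.2)

end Cabling

section Drinfeld

variable {k : Type*} [Field k] {lam : k} {Φ : NCSeries k} {n : ℕ}

/-- The image `Φ(t_{i,i+1}, Y_i) s_i e^{lam t_{i,i+1}} Φ(Y_i, t_{i,i+1})` of the Artin generator
`σ_i` in the completion of `𝔅_n`. -/
def drinfeldElt (lam : k) (Φ : NCSeries k) (i : Fin (n - 1)) : (InfBraid k n)⟦X⟧ :=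
  braidElt lam Φ (braidS k (transp i)) (braidT k (lo i) (hi i)) (braidY k (lo i))

theorem braidS_sq (i : Fin (n - 1)) : braidS k (transp i) * braidS k (transp i) = 1 := by
  rw [← braidS_mul, transp, Equiv.swap_mul_self, braidS_one]

theorem commute_braidT_braidY {a b r : Fin n} (hab : a ≠ b) (ha : a < r) (hb : b < r) :
    Commute (braidT k a b) (braidY k r) := by
  have ht := braidT_rels k (n := n)
  unfold braidY
  have ha' : a ∈ Finset.univ.filter (fun i => i < r) := by simp [ha]
  have hb' : b ∈ (Finset.univ.filter (fun i => i < r)).erase a := by simp [hb, hab.symm]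
  rw [← Finset.add_sum_erase _ _ ha', ← Finset.add_sum_erase _ _ hb', ← add_assoc]
  refine Commute.add_right ?_ (Commute.sum_right _ _ _ fun l hl => ?_)
  · have h := ht.four a b r
    rwa [ht.symm r b] at h
  · simp only [Finset.mem_erase, Finset.mem_filter, Finset.mem_univ, true_and] at hl
    exact ht.comm a b l r hab hl.2.1.symm ha.ne hl.1.symm hb.ne hl.2.2.ne

theorem lo_ne_hi (i : Fin (n - 1)) : lo i ≠ hi i := by simp [Fin.ext_iff, lo, hi]

theorem transp_lo (i : Fin (n - 1)) : transp i (lo i) = hi i := Equiv.swap_apply_left _ _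

theorem transp_hi (i : Fin (n - 1)) : transp i (hi i) = lo i := Equiv.swap_apply_right _ _

theorem transp_ne {i : Fin (n - 1)} {a : Fin n} (h1 : (a : ℕ) ≠ i) (h2 : (a : ℕ) ≠ i + 1) :
    transp i a = a :=
  Equiv.swap_apply_of_ne_of_ne (by simpa [Fin.ext_iff, lo] using h1)
    (by simpa [Fin.ext_iff, hi] using h2)

theorem IsAssociator.drinfeldElt_comm {i j : Fin (n - 1)} (hij : (i : ℕ) + 2 ≤ j) :
    Commute (drinfeldElt lam Φ i) (drinfeldElt lam Φ j) := by
  have ht := braidT_rels k (n := n)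
  have vlo (i : Fin (n - 1)) : ((lo i : Fin n) : ℕ) = i := rfl
  have vhi (i : Fin (n - 1)) : ((hi i : Fin n) : ℕ) = i + 1 := rfl
  have fix_j : ∀ a : Fin n, (a : ℕ) < j → transp j a = a := fun a ha =>
    transp_ne (by omega) (by omega)
  have fix_i : ∀ a : Fin n, (j : ℕ) ≤ a → transp i a = a := fun a ha =>
    transp_ne (by omega) (by omega)
  have Slt : ∀ a : Fin n, transp i a < lo j ↔ a < lo j := by
    intro a
    simp only [Fin.lt_def, vlo]
    by_cases h1 : a = lo i
    · subst h1; rw [transp_lo, vhi, vlo]; omega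
    by_cases h2 : a = hi i
    · subst h2; rw [transp_hi, vhi, vlo]; omega
    rw [transp_ne (by simpa [Fin.ext_iff, lo] using h1) (by simpa [Fin.ext_iff, hi] using h2)]
  apply commute_braidElt
  · unfold Commute SemiconjBy
    rw [← braidS_mul, ← braidS_mul, transp_comm hij]
  · have h := braidS_conj k (transp i) (lo j) (hi j)
    rwa [fix_i _ (by simp [vlo]), fix_i _ (by simp [vhi])] at h
  · unfold braidY Commute SemiconjBy
    rw [Finset.mul_sum, Finset.sum_mul]
    refine Finset.sum_equiv (transp i) (fun a => by simp [Slt]) fun a _ => ?_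
    have h := braidS_conj k (transp i) a (lo j)
    rwa [fix_i (lo j) (by simp [vlo])] at h
  · have h := braidS_conj k (transp j) (lo i) (hi i)
    rw [fix_j _ (by rw [vlo]; omega), fix_j _ (by rw [vhi]; omega)] at h
    exact Commute.symm h
  · refine ht.comm _ _ _ _ ?_ ?_ ?_ ?_ ?_ ?_ <;> simp only [ne_eq, Fin.ext_iff, vlo, vhi] <;> omega
  · refine commute_braidT_braidY (lo_ne_hi i) ?_ ?_ <;> simp only [Fin.lt_def, vlo, vhi] <;> omega
  · refine Commute.sum_left _ _ _ fun a ha => ?_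
    simp only [Finset.mem_filter, Finset.mem_univ, true_and, Fin.lt_def, vlo] at ha
    have h := braidS_conj k (transp j) a (lo i)
    rw [fix_j a (by omega), fix_j _ (by rw [vlo]; omega)] at h
    exact Commute.symm h
  · refine Commute.sum_left _ _ _ fun a ha => ?_
    simp only [Finset.mem_filter, Finset.mem_univ, true_and, Fin.lt_def, vlo] at ha
    refine ht.comm _ _ _ _ ?_ ?_ ?_ ?_ ?_ ?_ <;> simp only [ne_eq, Fin.ext_iff, vlo, vhi] <;> omega
  · refine Commute.sum_left _ _ _ fun a ha => ?_
    simp only [Finset.mem_filter, Finset.mem_univ, true_and, Fin.lt_def, vlo] at ha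
    refine commute_braidT_braidY ?_ ?_ ?_ <;> simp only [ne_eq, Fin.ext_iff, Fin.lt_def, vlo] <;>
      omega

variable [CharZero k]

theorem IsAssociator.drinfeldElt_braid (hΦ : IsAssociator lam Φ) {i j : Fin (n - 1)}
    (hij : (i : ℕ) + 1 = j) :
    drinfeldElt lam Φ i * drinfeldElt lam Φ j * drinfeldElt lam Φ i =
      drinfeldElt lam Φ j * drinfeldElt lam Φ i * drinfeldElt lam Φ j := by
  have hj : (lo j : Fin n) = hi i := by simp [lo, hi, hij]
  have vlo (i : Fin (n - 1)) : ((lo i : Fin n) : ℕ) = i := rfl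
  have vhi (i : Fin (n - 1)) : ((hi i : Fin n) : ℕ) = i + 1 := rfl
  set L : Finset (Fin n) := Finset.univ.filter (fun a => a < lo i) with hL
  set S : Fin 4 → Finset (Fin n) := ![L, {lo i}, {hi i}, {hi j}] with hS
  have memL (a : Fin n) (ha : a ∈ L) : (a : ℕ) < i := by
    simpa [hL, Fin.lt_def, vlo] using ha
  have disj : ∀ a b, a ≠ b → Disjoint (S a) (S b) := by
    have d1 : lo i ∉ L := fun h => by have := memL _ h; rw [vlo] at this; omega
    have d2 : hi i ∉ L := fun h => by have := memL _ h; rw [vhi] at this; omega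
    have d3 : hi j ∉ L := fun h => by have := memL _ h; rw [vhi] at this; omega
    have d4 : (lo i : Fin n) ≠ hi i := lo_ne_hi i
    have d5 : (lo i : Fin n) ≠ hi j := by simp only [ne_eq, Fin.ext_iff, vlo, vhi]; omega
    have d6 : (hi i : Fin n) ≠ hi j := by simp only [ne_eq, Fin.ext_iff, vhi]; omega
    intro a b hab
    fin_cases a <;> fin_cases b <;>
      simp_all [d4.symm, d5.symm, d6.symm]
  have hT := cable_rels (braidT_rels k (n := n)) disj
  set T := cable (braidT k (n := n)) S with hTdef
  have T01 : T 0 1 = ∑ a ∈ L, braidT k a (lo i) := by simp [hTdef, cable, hS]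
  have T02 : T 0 2 = ∑ a ∈ L, braidT k a (hi i) := by simp [hTdef, cable, hS]
  have T12 : T 1 2 = braidT k (lo i) (hi i) := by simp [hTdef, cable, hS]
  have T13 : T 1 3 = braidT k (lo i) (hi j) := by simp [hTdef, cable, hS]
  have T23 : T 2 3 = braidT k (hi i) (hi j) := by simp [hTdef, cable, hS]
  have Yi : braidY k (lo i) = T 0 1 := by rw [T01]; rfl
  have Yj : braidY k (lo j) = T 0 2 + T 1 2 := by
    have e : Finset.univ.filter (fun a => a < lo j) = insert (lo i) L := by
      ext a
      simp only [hL, Finset.mem_filter, Finset.mem_univ, true_and, Finset.mem_insert, Fin.lt_def,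
        Fin.ext_iff, vlo]
      omega
    rw [braidY, e, Finset.sum_insert (by simp [hL]), T02, T12, hj, add_comm]
  have key := hΦ.braid_four hT (p := braidS k (transp i)) (q := braidS k (transp j))
  have ti (a : Fin n) (ha : a ∈ L) : transp i a = a := by
    have := memL a ha
    exact transp_ne (by omega) (by omega)
  have tj (a : Fin n) (ha : a ∈ L) : transp j a = a := by
    have := memL a ha
    exact transp_ne (by omega) (by omega)
  have ti3 : transp i (hi j) = hi j := transp_ne (by rw [vhi]; omega) (by rw [vhi]; omega)
  have tj1 : transp j (lo i) = lo i := transp_ne (by rw [vlo]; omega) (by rw [vlo]; omega)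
  have tj2 : transp j (hi i) = hi j := by rw [← hj, transp_lo]
  have tj3 : transp j (hi j) = hi i := by rw [transp_hi, hj]
  have symm := (braidT_rels k (n := n)).symm
  have cj (g : Equiv.Perm (Fin n)) {a b c d : Fin n} (h1 : g a = c) (h2 : g b = d) :
      SemiconjBy (braidS k g) (braidT k a b) (braidT k c d) := by
    subst h1 h2; exact braidS_conj k g a b
  have res := key
    (by rw [← braidS_mul, ← braidS_mul, ← braidS_mul, ← braidS_mul, transp_braid hij])
    (by rw [T01, T02]; exact semiconj_sum _ fun a ha => cj _ (ti a ha) (transp_lo i))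
    (by rw [T01, T02]; exact semiconj_sum _ fun a ha => cj _ (ti a ha) (transp_hi i))
    (by rw [T12]; nth_rw 2 [symm]; exact cj _ (transp_lo i) (transp_hi i))
    (by rw [T13, T23]; exact cj _ (transp_lo i) ti3)
    (by rw [T13, T23]; exact cj _ (transp_hi i) ti3)
    (by rw [T01]; exact semiconj_sum _ fun a ha => cj _ (tj a ha) tj1)
    (by rw [T23]; nth_rw 2 [symm]; exact cj _ tj2 tj3)
    (by rw [T12, T13]; exact cj _ tj1 tj2)
    (by rw [T12, T13]; exact cj _ tj1 tj3)
  rw [← Yi, ← Yj, T12, T23, ← hj] at res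
  simpa only [drinfeldElt, hj] using res

/-- The image of the Artin generator `σ_i`, as an invertible element. -/
def IsAssociator.drinfeldUnit (hΦ : IsAssociator lam Φ) (i : Fin (n - 1)) :
    ((InfBraid k n)⟦X⟧)ˣ where
  val := drinfeldElt lam Φ i
  inv := Φ.eval (braidT k (lo i) (hi i)) (braidY k (lo i)) *
    expX k (lam • -braidT k (lo i) (hi i)) * PowerSeries.C (braidS k (transp i)) *
    Φ.eval (braidY k (lo i)) (braidT k (lo i) (hi i))
  val_inv := hΦ.braidElt_mul_inv (braidS_sq i)
  inv_val := hΦ.inv_mul_braidElt (braidS_sq i)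

/-- The morphism from `B_n` to the invertible elements of the completion of `𝔅_n` defined by an
associator: `σ_i ↦ Φ(t_{i,i+1}, Y_i) s_i e^{lam t_{i,i+1}} Φ(Y_i, t_{i,i+1})`. -/
def IsAssociator.drinfeldHom (hΦ : IsAssociator lam Φ) (n : ℕ) :
    BraidGroup n →* ((InfBraid k n)⟦X⟧)ˣ :=
  PresentedGroup.toGroup (f := hΦ.drinfeldUnit) (by
    rintro r (⟨i, j, h, rfl⟩ | ⟨i, j, h, rfl⟩)
    · simp only [map_mul, map_inv, FreeGroup.lift_apply_of, mul_inv_eq_one]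
      exact Units.ext (hΦ.drinfeldElt_braid h)
    · simp only [map_mul, map_inv, FreeGroup.lift_apply_of, mul_inv_eq_one]
      exact Units.ext (IsAssociator.drinfeldElt_comm h).eq)

theorem IsAssociator.drinfeldHom_of (hΦ : IsAssociator lam Φ) (i : Fin (n - 1)) :
    (hΦ.drinfeldHom n (.of i) : (InfBraid k n)⟦X⟧) = drinfeldElt lam Φ i := by
  simp [IsAssociator.drinfeldHom, IsAssociator.drinfeldUnit]

/-- A power series with matrix coefficients, as a matrix of power series. -/
def matrixOfSeries (k : Type*) [CommRing k] (N : ℕ) :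
    (Matrix (Fin N) (Fin N) k)⟦X⟧ →+* Matrix (Fin N) (Fin N) k⟦X⟧ where
  toFun x := .of fun i j => .mk fun d => PowerSeries.coeff d x i j
  map_one' := by
    ext i j d
    simp only [Matrix.of_apply, PowerSeries.coeff_mk, PowerSeries.coeff_one, Matrix.one_apply]
    by_cases hd : d = 0 <;> by_cases hij : i = j <;>
      simp [hd, hij, PowerSeries.coeff_one, Matrix.one_apply]
  map_zero' := by ext i j d; simp
  map_add' x y := by ext i j d; simp
  map_mul' x y := by
    ext i j d
    simp only [Matrix.of_apply, PowerSeries.coeff_mk, PowerSeries.coeff_mul, Matrix.mul_apply,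
      Matrix.sum_apply, map_sum]
    rw [Finset.sum_comm]

/-- The representation `Φ̂(ρ)` of `B_n` over `k⟦h⟧`: the composition of the Drinfeld morphism with
the extension `t_{ij} ↦ h ρ(t_{ij})` of `ρ` to the completion of `𝔅_n`. -/
def IsAssociator.monodromy (hΦ : IsAssociator lam Φ) {N : ℕ}
    (ρ : InfBraid k n →ₐ[k] Matrix (Fin N) (Fin N) k) : BraidGroup n →* GL (Fin N) k⟦X⟧ :=
  (Units.map ((matrixOfSeries k N).comp (PowerSeries.map (ρ : InfBraid k n →+* _))).toMonoidHom).comp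
    (hΦ.drinfeldHom n)

end Drinfeld

/-! ### Discrete valuation subrings and algebraic hulls -/

section Hull

attribute [local instance] LieRing.ofAssociativeRing

variable {k : Type*} [Field k]

/-- A discrete valuation subring `A` of `k⟦h⟧`: a subring containing `k[h]` on which the `h`-adic
valuation induces the structure of a discrete valuation ring with local parameter `h`, that is,
every non-zero element of `A` is a power of `h` times a unit of `A`. -/
structure IsDVSubring (A : Subalgebra k k⟦X⟧) : Prop where
  X_mem : PowerSeries.X ∈ A
  eq_pow_mul_unit : ∀ f ∈ A, f ≠ 0 →
    ∃ (d : ℕ) (u : Aˣ), f = PowerSeries.X ^ d * ((u : A) : k⟦X⟧)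

/-- A representation over `k⟦h⟧` whose matrix coefficients lie in the subring `A`, as a
representation over an `A`-algebra `K` (in the sequel, the quotient field of `A`). -/
def descend {G : Type*} [Group G] {N : ℕ} (R : G →* GL (Fin N) k⟦X⟧) (A : Subalgebra k k⟦X⟧)
    (hR : ∀ g i j, (R g : Matrix (Fin N) (Fin N) k⟦X⟧) i j ∈ A)
    (K : Type*) [Field K] [Algebra A K] : G →* GL (Fin N) K :=
  (Units.map (algebraMap A K).mapMatrix.toMonoidHom).comp <| MonoidHom.toHomUnits
    { toFun := fun g => (.of fun i j => ⟨(R g : Matrix _ _ k⟦X⟧) i j, hR g i j⟩ :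
        Matrix (Fin N) (Fin N) A)
      map_one' := by
        ext i j : 3
        by_cases hij : i = j <;> simp [hij, Matrix.one_apply]
      map_mul' := fun g g' => by
        ext i j : 3
        simp [Matrix.mul_apply] }

variable {K : Type*} [Field K] {N : ℕ}

/-- The Zariski closure of a subset of `GL_N(K)`, inside `GL_N(K)`. -/
def zariskiClosure (S : Set (GL (Fin N) K)) : Set (GL (Fin N) K) :=
  {g | ∀ p : MvPolynomial (Fin N × Fin N) K,
    (∀ s ∈ S, p.eval (fun ij => (s : Matrix (Fin N) (Fin N) K) ij.1 ij.2) = 0) →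
      p.eval (fun ij => (g : Matrix (Fin N) (Fin N) K) ij.1 ij.2) = 0}

/-- The Lie algebra of a Zariski-closed subgroup `Γ` of `GL_N(K)`, as a subspace of `gl_N(K)`: the
tangent space of `Γ` at the identity. It consists of the matrices at which the differential at the
identity of every polynomial function vanishing on `Γ` is zero. -/
def lieAlg (Γ : Set (GL (Fin N) K)) : Submodule K (Matrix (Fin N) (Fin N) K) where
  carrier := {x | ∀ p : MvPolynomial (Fin N × Fin N) K,
    (∀ g ∈ Γ, p.eval (fun ij => (g : Matrix (Fin N) (Fin N) K) ij.1 ij.2) = 0) →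
      ∑ ij : Fin N × Fin N, x ij.1 ij.2 *
        (MvPolynomial.pderiv ij p).eval (fun ij => (1 : Matrix (Fin N) (Fin N) K) ij.1 ij.2) = 0}
  zero_mem' := by intro p _; simp
  add_mem' := by
    intro x y hx hy p hp
    simp only [Matrix.add_apply, add_mul, Finset.sum_add_distrib, hx p hp, hy p hp, add_zero]
  smul_mem' := by
    intro c x hx p hp
    simp only [Matrix.smul_apply, smul_eq_mul, mul_assoc, ← Finset.mul_sum, hx p hp, mul_zero]

/-- The Lie subalgebra `ℋ_ρ = ρ(𝒯_n)` of `gl_N(k)`, generated by the `ρ(t_{ij})`. -/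
def hol {n : ℕ} (ρ : InfBraid k n →ₐ[k] Matrix (Fin N) (Fin N) k) :
    LieSubalgebra k (Matrix (Fin N) (Fin N) k) :=
  LieSubalgebra.lieSpan k _ {x | ∃ i j : Fin n, x = ρ (braidT k i j)}

/-- The Lie subalgebra `ρ(𝔉_n)` of `gl_N(k)`, generated by the `ρ(t_{in})`, `1 ≤ i ≤ n - 1`. -/
def holLast {n : ℕ} (ρ : InfBraid k n →ₐ[k] Matrix (Fin N) (Fin N) k) :
    LieSubalgebra k (Matrix (Fin N) (Fin N) k) :=
  LieSubalgebra.lieSpan k _ {x | ∃ i j : Fin n, i < j ∧ (j : ℕ) + 1 = n ∧ x = ρ (braidT k i j)}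

/-- The Lie subalgebra of `gl_N(k)` generated by the `ρ(t_{i,i+1})`, `1 ≤ i ≤ n - 1`. -/
def holConsecutive {n : ℕ} (ρ : InfBraid k n →ₐ[k] Matrix (Fin N) (Fin N) k) :
    LieSubalgebra k (Matrix (Fin N) (Fin N) k) :=
  LieSubalgebra.lieSpan k _ {x | ∃ i : Fin (n - 1), x = ρ (braidT k (lo i) (hi i))}

/-- The extension of scalars `L ⊗_k K`, for a subspace `L` of `gl_N(k)`, inside `gl_N(K)`: the
`K`-span of `L`. -/
def extendScalars (A : Subalgebra k k⟦X⟧) (K : Type*) [Field K] [Algebra A K]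
    (L : LieSubalgebra k (Matrix (Fin N) (Fin N) k)) : Submodule K (Matrix (Fin N) (Fin N) K) :=
  Submodule.span K
    ((fun x => x.map fun c => algebraMap A K (algebraMap k A c)) '' (L : Set (Matrix _ _ k)))

end Hull

end BraidHull

end

open BraidHull

/-! Tangency is first studied over `k⟦X⟧`, where `X` plays the role of $h$, and transferred to `K`
at the end.

The image of $\xi_{ij}$ is the exponential of $hy$, where the leading coefficient of $y$ is
$2\lambda t_{ij}$ and all coefficients of $y$ lie in the Lie algebra generated by the $t_{lj}$ with
$l<j$ (`hasLog_xi`). Indeed $\sigma_i^2\mapsto\Phi(t,Y)e^{2\lambda t}\Phi(Y,t)$, since $s_i$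
commutes with $t=t_{i,i+1}$, and $\xi_{i,j+1}=\sigma_j\xi_{ij}\sigma_j^{-1}$. Since $\Phi$ is
group-like, conjugation by $\Phi(a,b)$ is $\Phi(\mathrm{ad}\,a,\mathrm{ad}\,b)$. It therefore
preserves every subspace stable under $\mathrm{ad}\,a$ and $\mathrm{ad}\,b$, and the infinitesimal
braid relations supply this stability (`conjMaps_drinfeldElt`).

If a polynomial vanishes at all powers $e^{mhy}$, then it vanishes at $e^{zhy}$ for a formal $z$,
because each coefficient in $h$ is a polynomial in $z$ with infinitely many roots. Differentiating
at $z=0$ and cancelling $h$ shows that $y$ is tangent (`isTangent_of_exp`). This applies to every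
power $\xi_{ij}^m$ with $m\ne0$, at the cost of the invertible scalar $m$.

Tangent matrices are closed under brackets. So if the leading coefficients of such $y$ generate a
Lie algebra $H$ that contains all their coefficients, every element of $H$ lifts to a tangent matrix
with coefficients in $H$. Successive approximation in powers of $h$ then shows that the constant
matrices in $H$ are themselves tangent (`isTangent_of_reduction`). Clearing denominators passes from
`k⟦X⟧` to `K` (`extendScalars_le_lieAlg`).

All parts of the claim follow from the single criterion `isTangent_monodromy`, for different
generating sets. -/

namespace BraidHull

/-! ### Directional derivatives of polynomial functions on matrices -/

section Tangent

variable {O : Type*} [CommRing O] {N : ℕ}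

/-- The value at a matrix of a polynomial in the matrix entries. -/
noncomputable def evalAt (p : MvPolynomial (Fin N × Fin N) O) (g : Matrix (Fin N) (Fin N) O) : O :=
  p.eval fun ij => g ij.1 ij.2

/-- The derivative at `g`, in the direction `v`, of a polynomial in the matrix entries. -/
noncomputable def dirDeriv (p : MvPolynomial (Fin N × Fin N) O) (g v : Matrix (Fin N) (Fin N) O) : O :=
  ∑ ij : Fin N × Fin N, v ij.1 ij.2 * evalAt (MvPolynomial.pderiv ij p) g

theorem dirDeriv_add_right (p : MvPolynomial (Fin N × Fin N) O)
    (g v w : Matrix (Fin N) (Fin N) O) :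
    dirDeriv p g (v + w) = dirDeriv p g v + dirDeriv p g w := by
  simp only [dirDeriv, Matrix.add_apply, add_mul, Finset.sum_add_distrib]

theorem dirDeriv_smul_right (p : MvPolynomial (Fin N × Fin N) O) (c : O)
    (g v : Matrix (Fin N) (Fin N) O) : dirDeriv p g (c • v) = c * dirDeriv p g v := by
  simp only [dirDeriv, Matrix.smul_apply, smul_eq_mul, mul_assoc, Finset.mul_sum]

theorem dirDeriv_sub_right (p : MvPolynomial (Fin N × Fin N) O)
    (g v w : Matrix (Fin N) (Fin N) O) :
    dirDeriv p g (v - w) = dirDeriv p g v - dirDeriv p g w := by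
  simp only [dirDeriv, Matrix.sub_apply, sub_mul, Finset.sum_sub_distrib]

theorem dirDeriv_C (c : O) (g v : Matrix (Fin N) (Fin N) O) :
    dirDeriv (MvPolynomial.C c) g v = 0 := by
  simp [dirDeriv, evalAt]

theorem dirDeriv_X (ij : Fin N × Fin N) (g v : Matrix (Fin N) (Fin N) O) :
    dirDeriv (MvPolynomial.X ij) g v = v ij.1 ij.2 := by
  rw [dirDeriv, Finset.sum_eq_single ij]
  · simp [evalAt]
  · intro b _ hb
    simp [evalAt, MvPolynomial.pderiv_X_of_ne hb.symm]
  · simp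

theorem dirDeriv_add (p q : MvPolynomial (Fin N × Fin N) O) (g v : Matrix (Fin N) (Fin N) O) :
    dirDeriv (p + q) g v = dirDeriv p g v + dirDeriv q g v := by
  simp only [dirDeriv, evalAt, map_add, mul_add, Finset.sum_add_distrib]

theorem dirDeriv_mul (p q : MvPolynomial (Fin N × Fin N) O) (g v : Matrix (Fin N) (Fin N) O) :
    dirDeriv (p * q) g v = evalAt p g * dirDeriv q g v + dirDeriv p g v * evalAt q g := by
  simp only [dirDeriv, evalAt, Derivation.leibniz, map_add, smul_eq_mul, map_mul, Finset.mul_sum,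
    Finset.sum_mul, ← Finset.sum_add_distrib]
  exact Finset.sum_congr rfl fun _ _ => by ring

/-- The chain rule: a point derivation of an `O`-algebra `B`, evaluated on the value of a
polynomial at a matrix over `B`. -/
theorem derivation_eval₂ {B : Type*} [CommRing B] (φ : O →+* B) (e : B →+* O) (D : B →+ O)
    (hD : ∀ a b, D (a * b) = e a * D b + D a * e b) (he : ∀ c, e (φ c) = c)
    (hφ : ∀ c, D (φ c) = 0) (M : Matrix (Fin N) (Fin N) B)
    (p : MvPolynomial (Fin N × Fin N) O) :
    D (p.eval₂ φ fun ij => M ij.1 ij.2) = dirDeriv p (M.map e) (M.map D) := by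
  -- The Leibniz rule for `D` involves the values under `e`, so these are identified before the
  -- induction on `p`.
  have hev (p : MvPolynomial (Fin N × Fin N) O) :
      e (p.eval₂ φ fun ij => M ij.1 ij.2) = evalAt p (M.map e) := by
    rw [MvPolynomial.eval₂_comp_left, evalAt, ← MvPolynomial.eval₂_id]
    congr 1
    ext c
    exact he c
  induction p using MvPolynomial.induction_on with
  | C a => rw [MvPolynomial.eval₂_C, hφ, dirDeriv_C]
  | add p q hp hq => rw [MvPolynomial.eval₂_add, map_add, hp, hq, dirDeriv_add]
  | mul_X p ij hp =>
    rw [MvPolynomial.eval₂_mul, hD, hp, hev, dirDeriv_mul, dirDeriv_X, MvPolynomial.eval₂_X]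
    simp [evalAt]

/-- The left-invariant vector field on matrices with value `y` at the identity. -/
noncomputable def invField (y : Matrix (Fin N) (Fin N) O) :
    Derivation O (MvPolynomial (Fin N × Fin N) O) (MvPolynomial (Fin N × Fin N) O) :=
  MvPolynomial.mkDerivation O fun ij =>
    ∑ l, MvPolynomial.C (y l ij.2) * MvPolynomial.X (ij.1, l)

theorem invField_X (y : Matrix (Fin N) (Fin N) O) (ij : Fin N × Fin N) :
    invField y (MvPolynomial.X ij) =
      ∑ l, MvPolynomial.C (y l ij.2) * MvPolynomial.X (ij.1, l) :=
  MvPolynomial.mkDerivation_X ..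

/-- This is the chain rule `derivation_eval₂` for the generic matrix $(X_{ij})$: the vector field
sends it to $(X_{ij})\,y$, which takes the value $gy$ at $g$. -/
theorem evalAt_invField (y g : Matrix (Fin N) (Fin N) O) (p : MvPolynomial (Fin N × Fin N) O) :
    evalAt (invField y p) g = dirDeriv p g (g * y) := by
  let ev := MvPolynomial.eval fun ij : Fin N × Fin N => g ij.1 ij.2
  have h := derivation_eval₂ (MvPolynomial.C (σ := Fin N × Fin N) (R := O)) ev
    (ev.toAddMonoidHom.comp ((invField y : _ →ₗ[O] _).toAddMonoidHom))
    (fun a b => by simp [mul_comm]) (fun c => by simp [ev]) (fun c => by simp)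
    (.of fun i j => MvPolynomial.X (i, j)) p
  simp only [Matrix.of_apply, Prod.mk.eta] at h
  rw [show (p.eval₂ MvPolynomial.C fun ij => MvPolynomial.X ij) = p from
    MvPolynomial.eval₂_eta p] at h
  refine Eq.trans h ?_
  congr 1
  · ext i j; simp [ev]
  · ext i j
    simp [ev, invField_X, Matrix.mul_apply, mul_comm]

/-- A derivation of the polynomial ring is determined on the variables. On the generic matrix $X$,
applying the field of $y$ and then that of $x$ gives $Xxy$, so the commutator of the two fields
gives $X(xy-yx)$. -/
theorem invField_lie (x y : Matrix (Fin N) (Fin N) O) :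
    invField (x * y - y * x) = ⁅invField x, invField y⁆ := by
  have key (x y : Matrix (Fin N) (Fin N) O) (ij : Fin N × Fin N) :
      invField x (invField y (.X ij)) =
        ∑ l, MvPolynomial.C ((x * y) l ij.2) * MvPolynomial.X (ij.1, l) := by
    simp only [invField_X, map_sum, Derivation.leibniz, Derivation.leibniz, smul_eq_mul,
      MvPolynomial.derivation_C, mul_zero, add_zero, Matrix.mul_apply, map_mul, Finset.mul_sum,
      Finset.sum_mul]
    rw [Finset.sum_comm]
    exact Finset.sum_congr rfl fun _ _ => Finset.sum_congr rfl fun _ _ => by ring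
  refine MvPolynomial.derivation_ext fun ij => ?_
  rw [Derivation.commutator_apply, key, key, invField_X, ← Finset.sum_sub_distrib]
  exact Finset.sum_congr rfl fun _ _ => by rw [Matrix.sub_apply, map_sub, sub_mul]

/-- The polynomial function `x ↦ p (g x)`. -/
noncomputable def leftTranslate (g : Matrix (Fin N) (Fin N) O)
    (p : MvPolynomial (Fin N × Fin N) O) : MvPolynomial (Fin N × Fin N) O :=
  p.eval₂ MvPolynomial.C fun ij => ∑ l, MvPolynomial.C (g ij.1 l) * MvPolynomial.X (l, ij.2)

theorem evalAt_leftTranslate (g x : Matrix (Fin N) (Fin N) O)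
    (p : MvPolynomial (Fin N × Fin N) O) : evalAt (leftTranslate g p) x = evalAt p (g * x) := by
  rw [evalAt, leftTranslate, MvPolynomial.eval₂_comp_left, evalAt, ← MvPolynomial.eval₂_id]
  congr 1
  · ext c; simp
  · ext ij; simp [Matrix.mul_apply]

/-- The chain rule for the point derivation at the identity in direction $y$, evaluated on the
matrix $g\cdot(X_{ij})$. -/
theorem dirDeriv_leftTranslate (g y : Matrix (Fin N) (Fin N) O)
    (p : MvPolynomial (Fin N × Fin N) O) :
    dirDeriv (leftTranslate g p) 1 y = dirDeriv p g (g * y) := by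
  let ev := MvPolynomial.eval fun ij : Fin N × Fin N => (1 : Matrix (Fin N) (Fin N) O) ij.1 ij.2
  let D : MvPolynomial (Fin N × Fin N) O →+ O :=
    { toFun := fun q => dirDeriv q 1 y
      map_zero' := by simpa using dirDeriv_C 0 1 y
      map_add' := fun p q => dirDeriv_add p q 1 y }
  have h := derivation_eval₂ (MvPolynomial.C (σ := Fin N × Fin N) (R := O)) ev D
    (fun a b => dirDeriv_mul a b 1 y) (fun c => by simp [ev]) (fun c => dirDeriv_C c 1 y)
    (.of fun i j => ∑ l, MvPolynomial.C (g i l) * MvPolynomial.X (l, j)) p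
  refine Eq.trans h ?_
  congr 1
  · ext i j; simp [ev, Matrix.one_apply]
  · ext i j
    have (c : O) (ij : Fin N × Fin N) : D (.C c * .X ij) = c * y ij.1 ij.2 := by
      refine (dirDeriv_mul _ _ _ _).trans ?_
      simp [dirDeriv_C, dirDeriv_X, evalAt]
    simp [this, Matrix.mul_apply]

/-- The polynomial functions that vanish on `Γ`. -/
def VanishesOn (Γ : Submonoid (Matrix (Fin N) (Fin N) O))
    (p : MvPolynomial (Fin N × Fin N) O) : Prop :=
  ∀ g ∈ Γ, evalAt p g = 0

/-- The matrices tangent at the identity to the Zariski closure of `Γ`. -/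
def IsTangent (Γ : Submonoid (Matrix (Fin N) (Fin N) O)) (y : Matrix (Fin N) (Fin N) O) : Prop :=
  ∀ p, VanishesOn Γ p → dirDeriv p 1 y = 0

/-! ### The tangent space at the identity is a Lie algebra -/

variable {Γ : Submonoid (Matrix (Fin N) (Fin N) O)}

/-- For $g\in\Gamma$ the translate $x\mapsto p(gx)$ still vanishes on $\Gamma$, so tangency at the
identity propagates to tangency of $gy$ at $g$. Closure under multiplication suffices, which is why
$\Gamma$ is only a submonoid. -/
theorem IsTangent.vanishesOn_invField {y : Matrix (Fin N) (Fin N) O} (hy : IsTangent Γ y)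
    {p : MvPolynomial (Fin N × Fin N) O} (hp : VanishesOn Γ p) :
    VanishesOn Γ (invField y p) := by
  intro g hg
  rw [evalAt_invField, ← dirDeriv_leftTranslate]
  refine hy _ fun x hx => ?_
  rw [evalAt_leftTranslate]
  exact hp _ (Γ.mul_mem hg hx)

/-- The invariant fields of tangent vectors preserve the ideal of $\Gamma$, hence so does their
commutator, which is the invariant field of the bracket. -/
theorem IsTangent.lie {x y : Matrix (Fin N) (Fin N) O} (hx : IsTangent Γ x)
    (hy : IsTangent Γ y) : IsTangent Γ (x * y - y * x) := by
  intro p hp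
  have h1 := hx _ (hy.vanishesOn_invField hp)
  have h2 := hy _ (hx.vanishesOn_invField hp)
  have e (z : Matrix (Fin N) (Fin N) O) (q : MvPolynomial (Fin N × Fin N) O) :
      dirDeriv q 1 z = evalAt (invField z q) 1 := by rw [evalAt_invField, one_mul]
  rw [e] at h1 h2 ⊢
  rw [invField_lie, Derivation.commutator_apply, evalAt, map_sub]
  exact (congrArg₂ _ h1 h2).trans (sub_zero 0)

theorem IsTangent.add {x y : Matrix (Fin N) (Fin N) O} (hx : IsTangent Γ x)
    (hy : IsTangent Γ y) : IsTangent Γ (x + y) := fun p hp => by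
  rw [dirDeriv_add_right, hx p hp, hy p hp, add_zero]

theorem IsTangent.smul {x : Matrix (Fin N) (Fin N) O} (hx : IsTangent Γ x) (c : O) :
    IsTangent Γ (c • x) := fun p hp => by
  rw [dirDeriv_smul_right, hx p hp, mul_zero]

theorem isTangent_zero : IsTangent Γ (0 : Matrix (Fin N) (Fin N) O) := fun p _ => by
  simp [dirDeriv]

end Tangent

/-! ### Tangent vectors from one-parameter families of exponentials -/

section Exponential

variable {k : Type*} [Field k] {N : ℕ}

theorem coeff_zero_mul' {E : Type*} [Semiring E] (a b : E⟦X⟧) :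
    PowerSeries.coeff 0 (a * b) = PowerSeries.coeff 0 a * PowerSeries.coeff 0 b := by
  simp

theorem matrixOfSeries_apply (x : (Matrix (Fin N) (Fin N) k)⟦X⟧) (i j : Fin N) :
    matrixOfSeries k N x i j = PowerSeries.mk fun d => PowerSeries.coeff d x i j := rfl

theorem matrixOfSeries_C (x : Matrix (Fin N) (Fin N) k) :
    matrixOfSeries k N (PowerSeries.C x) = x.map PowerSeries.C := by
  ext i j d
  by_cases hd : d = 0 <;> simp [matrixOfSeries_apply, PowerSeries.coeff_C, hd]

theorem matrixOfSeries_X_mul (x : (Matrix (Fin N) (Fin N) k)⟦X⟧) :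
    matrixOfSeries k N (PowerSeries.X * x) = (PowerSeries.X : k⟦X⟧) • matrixOfSeries k N x := by
  ext i j d
  cases d <;> simp [matrixOfSeries_apply, PowerSeries.coeff_succ_X_mul]

/-- The coefficientwise derivative at `z = 0`, from `k[z]⟦h⟧` to `k⟦h⟧`. -/
noncomputable def derivAtZero (k : Type*) [Field k] : (Polynomial k)⟦X⟧ →+ k⟦X⟧ where
  toFun b := .mk fun d => (PowerSeries.coeff d b).coeff 1
  map_zero' := by ext; simp
  map_add' a b := by ext; simp

theorem derivAtZero_mul (a b : (Polynomial k)⟦X⟧) :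
    derivAtZero k (a * b) = PowerSeries.map (Polynomial.evalRingHom 0) a * derivAtZero k b +
      derivAtZero k a * PowerSeries.map (Polynomial.evalRingHom 0) b := by
  ext d
  simp only [derivAtZero, AddMonoidHom.coe_mk, ZeroHom.coe_mk, PowerSeries.coeff_mk,
    PowerSeries.coeff_mul, map_add, PowerSeries.coeff_map, ← Finset.sum_add_distrib,
    Polynomial.finsetSum_coeff, Polynomial.mul_coeff_one, Polynomial.coe_evalRingHom,
    Polynomial.coeff_zero_eq_eval_zero]

/-- Each coefficient is a polynomial in $z$ vanishing at all natural numbers, which form an infinite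
set in characteristic zero. -/
theorem series_eq_zero_of_eval_nat [CharZero k] {b : (Polynomial k)⟦X⟧}
    (h : ∀ m : ℕ, PowerSeries.map (Polynomial.evalRingHom (m : k)) b = 0) : b = 0 := by
  ext1 d
  refine Polynomial.eq_zero_of_infinite_isRoot _ ?_
  refine (Set.infinite_range_of_injective (Nat.cast_injective (R := k))).mono ?_
  rintro _ ⟨m, rfl⟩
  simpa using congrArg (PowerSeries.coeff d) (h m)

/-- The matrix `exp(z h x)` over `k[z]⟦h⟧`. -/
noncomputable def expFamily (x : Matrix (Fin N) (Fin N) k) :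
    Matrix (Fin N) (Fin N) (Polynomial k)⟦X⟧ :=
  .of fun i j => .mk fun d => .monomial d (((d.factorial : k))⁻¹ * (x ^ d) i j)

theorem expFamily_eval (x : Matrix (Fin N) (Fin N) k) (c : k) :
    (expFamily x).map (PowerSeries.map (Polynomial.evalRingHom c)) =
      matrixOfSeries k N (expX k (c • x)) := by
  ext i j d
  simp only [expFamily, Matrix.map_apply, Matrix.of_apply, PowerSeries.coeff_map,
    PowerSeries.coeff_mk, Polynomial.coe_evalRingHom, Polynomial.eval_monomial,
    matrixOfSeries_apply, expX, smul_pow, Matrix.smul_apply, smul_eq_mul]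
  ring

/-- Since $z$ and $h$ occur with equal exponents, only the term $zhx$ survives; this is the origin
of the factor $h$ that is cancelled later. -/
theorem expFamily_deriv (x : Matrix (Fin N) (Fin N) k) :
    (expFamily x).map (derivAtZero k) =
      (PowerSeries.X : k⟦X⟧) • matrixOfSeries k N (PowerSeries.C x) := by
  ext i j d
  rw [matrixOfSeries_C]
  simp only [expFamily, derivAtZero, Matrix.map_apply, Matrix.of_apply, PowerSeries.coeff_mk,
    Polynomial.coeff_monomial, AddMonoidHom.coe_mk, ZeroHom.coe_mk, Matrix.smul_apply,
    smul_eq_mul, mul_comm PowerSeries.X, PowerSeries.coeff_C_mul, PowerSeries.coeff_X]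
  by_cases hd : d = 1
  · subst hd; simp
  · simp [hd]

/-- The matrices $U e^{mhx}V$ are interpolated by $M(z)=Ue^{zhx}V$ over $k[z]⟦h⟧$. A polynomial
vanishing at every $M(m)$ vanishes identically along $M$, so its derivative at $z=0$ vanishes;
$M(0)=1$ and $M'(0)=h\,UxV$. -/
theorem isTangent_of_exp [CharZero k] {Γ : Submonoid (Matrix (Fin N) (Fin N) k⟦X⟧)}
    {U V : (Matrix (Fin N) (Fin N) k)⟦X⟧} (hUV : U * V = 1) {x : Matrix (Fin N) (Fin N) k}
    (h : ∀ m : ℕ, matrixOfSeries k N (U * expX k ((m : k) • x) * V) ∈ Γ) :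
    IsTangent Γ (matrixOfSeries k N (U * PowerSeries.C x * V)) := by
  intro p hp
  set φ : k⟦X⟧ →+* (Polynomial k)⟦X⟧ := PowerSeries.map Polynomial.C
  set e : k → (Polynomial k)⟦X⟧ →+* k⟦X⟧ := fun c => PowerSeries.map (Polynomial.evalRingHom c)
  have eφ (c : k) (f : k⟦X⟧) : e c (φ f) = f := by ext; simp [e, φ]
  have Dφ (f : k⟦X⟧) : derivAtZero k (φ f) = 0 := by
    ext; simp [derivAtZero, φ]
  -- The coefficients of `U`, `V` and `p` enter through `φ`, as constants in $z$; `e c` is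
  -- specialization at $z=c$.
  set M := (matrixOfSeries k N U).map φ * expFamily x * (matrixOfSeries k N V).map φ
  have Me (c : k) : M.map (e c) = matrixOfSeries k N (U * expX k (c • x) * V) := by
    simp only [M, Matrix.map_mul, map_mul, Matrix.map_map]
    rw [show (e c ∘ φ) = id from funext (eφ c), Matrix.map_id, Matrix.map_id, expFamily_eval]
  have MD : M.map (derivAtZero k) =
      (PowerSeries.X : k⟦X⟧) • matrixOfSeries k N (U * PowerSeries.C x * V) := by
    have e1 : M.map (derivAtZero k) =
        matrixOfSeries k N U * (expFamily x).map (derivAtZero k) * matrixOfSeries k N V := by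
      ext1 i j
      have hl (f : k⟦X⟧) (b : (Polynomial k)⟦X⟧) :
          derivAtZero k (φ f * b) = f * derivAtZero k b := by
        rw [derivAtZero_mul, Dφ, zero_mul, add_zero]
        exact congrArg (· * _) (eφ 0 f)
      have hr (f : k⟦X⟧) (b : (Polynomial k)⟦X⟧) :
          derivAtZero k (b * φ f) = derivAtZero k b * f := by rw [mul_comm, hl, mul_comm]
      simp only [M, Matrix.map_apply, Matrix.mul_apply, map_sum, hr, hl]
    rw [e1, expFamily_deriv, map_mul, map_mul, Matrix.mul_smul, Matrix.smul_mul]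
  have b0 : p.eval₂ φ (fun ij => M ij.1 ij.2) = 0 := by
    refine series_eq_zero_of_eval_nat fun m => ?_
    change e (m : k) _ = 0
    rw [MvPolynomial.eval₂_comp_left, ← hp _ (h m), ← Me, evalAt, ← MvPolynomial.eval₂_id]
    congr 1
    ext1 f
    exact eφ _ f
  have key := derivation_eval₂ φ (e 0) (derivAtZero k) derivAtZero_mul (eφ 0) Dφ M p
  rw [b0, map_zero, MD, Me, zero_smul, expX_zero, mul_one, hUV, map_one,
    dirDeriv_smul_right] at key
  -- The factor $h$ is cancelled in the domain `k⟦X⟧`.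
  exact (mul_eq_zero.mp key.symm).resolve_left PowerSeries.X_ne_zero

/-! ### Reduction modulo `h` -/

attribute [local instance] LieRing.ofAssociativeRing

theorem matrixOfSeries_smul (c : k) (y : (Matrix (Fin N) (Fin N) k)⟦X⟧) :
    matrixOfSeries k N (c • y) = (PowerSeries.C c : k⟦X⟧) • matrixOfSeries k N y := by
  ext i j d
  simp [matrixOfSeries_apply]

/-- If a Lie algebra of matrices over `k` is generated by the reductions modulo `h` of tangent
matrices over `k⟦h⟧` with all coefficients in this Lie algebra, then it consists of tangent
matrices. -/
theorem isTangent_of_reduction {Γ : Submonoid (Matrix (Fin N) (Fin N) k⟦X⟧)}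
    {S : Set (Matrix (Fin N) (Fin N) k)}
    (h : ∀ x ∈ S, ∃ y : (Matrix (Fin N) (Fin N) k)⟦X⟧,
      (∀ d, PowerSeries.coeff d y ∈ LieSubalgebra.lieSpan k _ S) ∧ PowerSeries.coeff 0 y = x ∧
        IsTangent Γ (matrixOfSeries k N y))
    {x : Matrix (Fin N) (Fin N) k} (hx : x ∈ LieSubalgebra.lieSpan k _ S) :
    IsTangent Γ (x.map PowerSeries.C) := by
  set H := LieSubalgebra.lieSpan k _ S
  -- Tangent lifts pass from the generators to all of `H`. A bracket is lifted by the commutator of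
  -- the lifts, whose coefficients are sums of brackets of coefficients and so remain in `H`.
  have lift : ∀ x ∈ H, ∃ y : (Matrix (Fin N) (Fin N) k)⟦X⟧,
      (∀ d, PowerSeries.coeff d y ∈ H) ∧ PowerSeries.coeff 0 y = x ∧
        IsTangent Γ (matrixOfSeries k N y) := by
    intro x hx
    induction hx using LieSubalgebra.lieSpan_induction with
    | mem x hx => exact h x hx
    | zero => exact ⟨0, fun d => by simp, by simp, by simpa using isTangent_zero⟩
    | add x y _ _ hx hy =>
      obtain ⟨a, ha, ha0, hat⟩ := hx
      obtain ⟨b, hb, hb0, hbt⟩ := hy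
      exact ⟨a + b, fun d => by rw [map_add]; exact H.add_mem (ha d) (hb d),
        by rw [map_add, ha0, hb0], by rw [map_add]; exact hat.add hbt⟩
    | smul c x _ hx =>
      obtain ⟨a, ha, ha0, hat⟩ := hx
      exact ⟨c • a, fun d => H.smul_mem c (ha d), congrArg (c • ·) ha0,
        by rw [matrixOfSeries_smul]; exact hat.smul _⟩
    | lie x y _ _ hx hy =>
      obtain ⟨a, ha, ha0, hat⟩ := hx
      obtain ⟨b, hb, hb0, hbt⟩ := hy
      refine ⟨a * b - b * a, fun d => ?_, ?_, ?_⟩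
      · rw [map_sub, PowerSeries.coeff_mul, PowerSeries.coeff_mul,
          ← Finset.Nat.sum_antidiagonal_swap, ← Finset.sum_sub_distrib]
        refine H.toSubmodule.sum_mem fun p _ => ?_
        exact H.lie_mem (ha _) (hb _)
      · simp only [map_sub, coeff_zero_mul', ha0, hb0, Ring.lie_def]
      · rw [map_sub, map_mul, map_mul]; exact hat.lie hbt
  intro p hp
  -- Successive approximation: subtracting from `z` a tangent lift of its constant coefficient does
  -- not change the derivative and leaves $h$ times a series with coefficients in `H`. Hence the
  -- derivative is divisible by every power of $h$.
  have key : ∀ (d : ℕ) (z : (Matrix (Fin N) (Fin N) k)⟦X⟧), (∀ d, PowerSeries.coeff d z ∈ H) →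
      PowerSeries.X ^ d ∣ dirDeriv p 1 (matrixOfSeries k N z) := by
    intro d
    induction d with
    | zero => intro z _; simp
    | succ d ih =>
      intro z hz
      obtain ⟨y, hy, hy0, hyt⟩ := lift _ (hz 0)
      have hzy : z - y =
          PowerSeries.X * PowerSeries.mk fun d => PowerSeries.coeff (d + 1) (z - y) := by
        conv_lhs => rw [PowerSeries.eq_X_mul_shift_add_const (z - y)]
        rw [← PowerSeries.coeff_zero_eq_constantCoeff_apply, map_sub, hy0, sub_self, map_zero,
          add_zero]
      have e : dirDeriv p 1 (matrixOfSeries k N z) =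
          dirDeriv p 1 (matrixOfSeries k N (z - y)) := by
        rw [map_sub, dirDeriv_sub_right, hyt p hp, sub_zero]
      rw [e, hzy, matrixOfSeries_X_mul, dirDeriv_smul_right, pow_succ']
      refine mul_dvd_mul_left _ (ih _ fun d => ?_)
      rw [PowerSeries.coeff_mk, map_sub]
      exact H.sub_mem (hz _) (hy _)
  rw [← matrixOfSeries_C]
  ext d
  refine PowerSeries.X_pow_dvd_iff.mp (key (d + 1) _ fun e => ?_) d d.lt_succ_self
  rw [PowerSeries.coeff_C]
  split_ifs
  · exact hx
  · exact H.zero_mem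

end Exponential

/-! ### Conjugation by exponentials and by associators -/

section Conjugation

variable {k : Type*} [Field k] {E : Type*} [Ring E] [Algebra k E]

/-- The map `y ↦ U y V` sends series with coefficients in `H` to series with coefficients
in `H'`. -/
def ConjMaps (H H' : Submodule k E) (U V : E⟦X⟧) : Prop :=
  ∀ y : E⟦X⟧, (∀ d, PowerSeries.coeff d y ∈ H) → ∀ d, PowerSeries.coeff d (U * y * V) ∈ H'

theorem ConjMaps.comp {H H' H'' : Submodule k E} {U V U' V' : E⟦X⟧} (h' : ConjMaps H' H'' U' V')
    (h : ConjMaps H H' U V) : ConjMaps H H'' (U' * U) (V * V') := by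
  intro y hy d
  have := h' _ (h y hy) d
  simpa only [mul_assoc] using this

theorem ConjMaps.mono {H H' H₁ H₁' : Submodule k E} {U V : E⟦X⟧} (h : ConjMaps H H' U V)
    (h1 : H₁ ≤ H) (h2 : H' ≤ H₁') : ConjMaps H₁ H₁' U V :=
  fun y hy d => h2 (h y (fun d => h1 (hy d)) d)

/-- Writing $y=Xy'+y_0$ and using that $X$ is central, the coefficient of degree $d$ reduces to the
constant $y_0$ and to a coefficient of smaller degree for $y'$. -/
theorem conjMaps_of_const {H H' : Submodule k E} {U V : E⟦X⟧}
    (h : ∀ x ∈ H, ∀ d, PowerSeries.coeff d (U * PowerSeries.C x * V) ∈ H') :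
    ConjMaps H H' U V := by
  intro y hy d
  induction d using Nat.strong_induction_on generalizing y with
  | _ d ih =>
    rw [PowerSeries.eq_X_mul_shift_add_const y, mul_add, add_mul, map_add]
    refine H'.add_mem ?_ (h _ (by simpa using hy 0) d)
    rw [← mul_assoc, (PowerSeries.commute_X U).eq, mul_assoc, mul_assoc]
    cases d with
    | zero => simp
    | succ d =>
      rw [PowerSeries.coeff_succ_X_mul, ← mul_assoc]
      exact ih d d.lt_succ_self _ fun e => by simpa using hy (e + 1)

theorem conjMaps_C {H H' : Submodule k E} {u v : E} (h : ∀ x ∈ H, u * x * v ∈ H') :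
    ConjMaps H H' (PowerSeries.C u) (PowerSeries.C v) := by
  refine conjMaps_of_const fun x hx d => ?_
  rw [← map_mul, ← map_mul, PowerSeries.coeff_C]
  split_ifs
  · exact h x hx
  · exact H'.zero_mem

/-- The commutator `x ↦ [a, x]`. -/
noncomputable def commutatorMap (k : Type*) [Field k] {E : Type*} [Ring E] [Algebra k E] (a : E) :
    Module.End k E :=
  LinearMap.mulLeft k a + -LinearMap.mulRight k a

theorem commutatorMap_apply (a x : E) : commutatorMap k a x = a * x - x * a := by
  simp [commutatorMap, sub_eq_add_neg]

theorem wordEval_apply_mem {H : Submodule k E} {f g : Module.End k E} (hf : ∀ x ∈ H, f x ∈ H)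
    (hg : ∀ x ∈ H, g x ∈ H) {x : E} (hx : x ∈ H) (w : List (Fin 2)) : wordEval f g w x ∈ H := by
  induction w with
  | nil => simpa [wordEval]
  | cons i w ih =>
    simp only [wordEval, List.map_cons, List.prod_cons, Module.End.mul_apply] at ih ⊢
    fin_cases i
    · exact hf _ ih
    · exact hg _ ih

theorem coeff_eval_apply_mem (Φ : NCSeries k) {H : Submodule k E} {f g : Module.End k E}
    (hf : ∀ x ∈ H, f x ∈ H) (hg : ∀ x ∈ H, g x ∈ H) {x : E} (hx : x ∈ H) (d : ℕ) :
    PowerSeries.coeff d (Φ.eval f g) x ∈ H := by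
  simp only [NCSeries.eval, PowerSeries.coeff_mk, LinearMap.sum_apply, LinearMap.smul_apply]
  exact H.sum_mem fun w _ => H.smul_mem _ (wordEval_apply_mem hf hg hx _)

theorem wordEval_apply_eq_zero {f g : Module.End k E} {x : E} (hf : f x = 0) (hg : g x = 0)
    {w : List (Fin 2)} (hw : w ≠ []) : wordEval f g w x = 0 := by
  -- The last letter is split off because it is the one that acts first on `x`.
  obtain ⟨w, i, rfl⟩ := (List.eq_nil_or_concat w).resolve_left hw
  simp only [wordEval, List.concat_eq_append, List.map_append, List.prod_append,
    Module.End.mul_apply, List.map_cons, List.map_nil, List.prod_singleton]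
  fin_cases i
  · simp [hf]
  · simp [hg]

/-- Every nonempty word kills `x`, so only the constant term of the series contributes; it is
expressed as $\Phi(0,0)$ so that `eval_zero` applies. -/
theorem coeff_eval_apply_of_eq_zero (Φ : NCSeries k) {f g : Module.End k E} {x : E}
    (hf : f x = 0) (hg : g x = 0) (d : ℕ) :
    PowerSeries.coeff d (Φ.eval f g) x = PowerSeries.coeff d (Φ.eval (0 : E) 0) * x := by
  cases d with
  | zero =>
    rw [eval_zero_zero]
    simp only [NCSeries.eval, PowerSeries.coeff_mk, LinearMap.sum_apply, LinearMap.smul_apply]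
    rw [Fintype.sum_eq_single List.Vector.nil (fun w hw => absurd (Subsingleton.elim w _) hw)]
    simp [wordEval, Algebra.algebraMap_eq_smul_one]
  | succ d =>
    rw [eval_zero_zero, PowerSeries.coeff_C, if_neg (Nat.succ_ne_zero d), zero_mul]
    simp only [NCSeries.eval, PowerSeries.coeff_mk, LinearMap.sum_apply, LinearMap.smul_apply]
    refine Finset.sum_eq_zero fun w _ => ?_
    rw [wordEval_apply_eq_zero hf hg, smul_zero]
    intro h
    have := congrArg List.length h
    simp at this

theorem coeff_mul_C_mul (U V : E⟦X⟧) (x : E) (d : ℕ) :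
    PowerSeries.coeff d (U * PowerSeries.C x * V) =
      ∑ p ∈ Finset.HasAntidiagonal.antidiagonal d, PowerSeries.coeff p.1 U * x * PowerSeries.coeff p.2 V := by
  rw [PowerSeries.coeff_mul]
  simp only [PowerSeries.coeff_mul_C]

/-- If `F` is the product of the left multiplications by the coefficients of `U` with `G`,
where the coefficients of `G` commute with left multiplications, and `F(1) = 1`, then `F` is the
conjugation by `U`. -/
theorem coeff_conj_of_factor {F G : (Module.End k E)⟦X⟧} {U V : E⟦X⟧} (hVU : V * U = 1)
    (hF : F = PowerSeries.map ((Algebra.lmul k E : E →ₐ[k] Module.End k E) : E →+* _) U * G)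
    (hG : ∀ d x, PowerSeries.coeff d G x = x * PowerSeries.coeff d G 1)
    (h1 : ∀ d, PowerSeries.coeff d F 1 = PowerSeries.coeff d (1 : E⟦X⟧)) (x : E) (d : ℕ) :
    PowerSeries.coeff d (U * PowerSeries.C x * V) = PowerSeries.coeff d F x := by
  have formula (x : E) (d : ℕ) : PowerSeries.coeff d F x =
      ∑ p ∈ Finset.HasAntidiagonal.antidiagonal d,
        PowerSeries.coeff p.1 U * x * PowerSeries.coeff p.2 G 1 := by
    rw [hF, PowerSeries.coeff_mul, LinearMap.sum_apply]
    refine Finset.sum_congr rfl fun p _ => ?_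
    rw [Module.End.mul_apply, hG, PowerSeries.coeff_map]
    simp [mul_assoc]
  -- The relation $F(1)=1$ says that the series of the $G_d(1)$ is a right inverse of `U`, so it
  -- equals the left inverse `V`.
  have hV : V = .mk fun d => PowerSeries.coeff d G 1 := by
    have : U * (.mk fun d => PowerSeries.coeff d G 1) = 1 := by
      ext d
      rw [← h1, formula, PowerSeries.coeff_mul]
      simp
    calc V = V * (U * _) := by rw [this, mul_one]
      _ = _ := by rw [← mul_assoc, hVU, one_mul]
  rw [formula, coeff_mul_C_mul, hV]
  simp only [PowerSeries.coeff_mk]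

theorem apply_eq_mul_of_commute {f : Module.End k E}
    (hf : ∀ x, Commute (LinearMap.mulLeft k x) f) (x : E) : f x = x * f 1 := by
  simpa using (LinearMap.congr_fun (hf x).eq 1).symm

theorem commute_mulLeft_neg_mulRight (a b : E) :
    Commute (LinearMap.mulLeft k a : Module.End k E) (-LinearMap.mulRight k b) :=
  Commute.neg_right (R := Module.End k E) (LinearMap.commute_mulLeft_right a b)

/-- Write $\mathrm{ad}\,a=L_a+(-R_a)$ with left and right multiplications, which commute.
Group-likeness gives $\Phi(\mathrm{ad}\,a,\mathrm{ad}\,b)=\Phi(L_a,L_b)\,\Phi(-R_a,-R_b)$. The first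
factor is left multiplication by $\Phi(a,b)$; the second commutes with left multiplications, hence
is a right multiplication. As $\mathrm{ad}\,a$ and $\mathrm{ad}\,b$ kill $1$, the product fixes $1$,
so the right multiplier is the inverse of $\Phi(a,b)$. -/
theorem IsAssociator.coeff_conj {lam : k} {Φ : NCSeries k} (hΦ : IsAssociator lam Φ) (a b x : E)
    (d : ℕ) : PowerSeries.coeff d (Φ.eval a b * PowerSeries.C x * Φ.eval b a) =
      PowerSeries.coeff d (Φ.eval (commutatorMap k a) (commutatorMap k b)) x := by
  refine coeff_conj_of_factor (G := Φ.eval (-LinearMap.mulRight k a) (-LinearMap.mulRight k b))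
    (hΦ.mul_swap a b) ?_ ?_ ?_ x d
  · rw [map_eval]
    exact hΦ.grouplike' (commute_mulLeft_neg_mulRight _ _) (commute_mulLeft_neg_mulRight _ _)
      (commute_mulLeft_neg_mulRight _ _) (commute_mulLeft_neg_mulRight _ _)
  · exact fun d => apply_eq_mul_of_commute fun x =>
      semiconj_coeff_eval (commute_mulLeft_neg_mulRight (k := k) x a).semiconjBy
        (commute_mulLeft_neg_mulRight (k := k) x b).semiconjBy Φ d
  · intro d
    rw [coeff_eval_apply_of_eq_zero Φ (by simp [commutatorMap_apply])
      (by simp [commutatorMap_apply]), hΦ.eval_zero, mul_one]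

theorem expX_neg_mul [CharZero k] (a : E) : expX k (-a) * expX k a = 1 := by
  rw [← expX_add (Commute.refl a).neg_left, neg_add_cancel, expX_zero]

/-- The argument of `coeff_conj`, with `expX_add` for commuting elements in place of group-likeness.
-/
theorem coeff_conj_expX [CharZero k] (a x : E) (d : ℕ) :
    PowerSeries.coeff d (expX k a * PowerSeries.C x * expX k (-a)) =
      PowerSeries.coeff d (expX k (commutatorMap k a)) x := by
  refine coeff_conj_of_factor (G := expX k (-LinearMap.mulRight k a)) (expX_neg_mul a) ?_ ?_ ?_ x d
  · rw [map_expX]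
    exact expX_add (commute_mulLeft_neg_mulRight _ _)
  · exact fun d => apply_eq_mul_of_commute fun x =>
      semiconj_coeff_expX (commute_mulLeft_neg_mulRight (k := k) x a).semiconjBy d
  · intro d
    cases d with
    | zero => simp [expX]
    | succ d => simp [expX, PowerSeries.coeff_one, pow_succ, commutatorMap_apply]

/-! ### Stable subspaces and logarithms -/

variable {H : Submodule k E}

theorem IsAssociator.conjMaps {lam : k} {Φ : NCSeries k} (hΦ : IsAssociator lam Φ) {a b : E}
    (ha : ∀ x ∈ H, a * x - x * a ∈ H) (hb : ∀ x ∈ H, b * x - x * b ∈ H) :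
    ConjMaps H H (Φ.eval a b) (Φ.eval b a) := by
  refine conjMaps_of_const fun x hx d => ?_
  rw [hΦ.coeff_conj]
  refine coeff_eval_apply_mem Φ (fun x hx => ?_) (fun x hx => ?_) hx d
  · rw [commutatorMap_apply]; exact ha x hx
  · rw [commutatorMap_apply]; exact hb x hx

theorem conjMaps_expX [CharZero k] {a : E} (ha : ∀ x ∈ H, a * x - x * a ∈ H) :
    ConjMaps H H (expX k a) (expX k (-a)) := by
  refine conjMaps_of_const fun x hx d => ?_
  rw [coeff_conj_expX, expX, PowerSeries.coeff_mk, LinearMap.smul_apply]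
  refine H.smul_mem _ ?_
  induction d with
  | zero => simpa
  | succ d ih => rw [pow_succ', Module.End.mul_apply, commutatorMap_apply]; exact ha _ ih

/-- The series `g` is the exponential of `Xy`, for a series `y` with coefficients in `H` and
constant coefficient `x`; moreover, `y` is conjugate to a constant. -/
def HasLog (H : Submodule k E) (x : E) (g : E⟦X⟧) : Prop :=
  ∃ (U V : E⟦X⟧) (a : E), U * V = 1 ∧ V * U = 1 ∧ g = U * expX k a * V ∧
    (∀ d, PowerSeries.coeff d (U * PowerSeries.C a * V) ∈ H) ∧
      PowerSeries.coeff 0 (U * PowerSeries.C a * V) = x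

theorem HasLog.conj {H' : Submodule k E} {x : E} {g U V : E⟦X⟧} (hg : HasLog H x g)
    (h : ConjMaps H H' U V) (hUV : U * V = 1) (hVU : V * U = 1) :
    HasLog H' (PowerSeries.coeff 0 U * x * PowerSeries.coeff 0 V) (U * g * V) := by
  obtain ⟨U', V', a, h1, h2, rfl, h3, rfl⟩ := hg
  have e (z : E⟦X⟧) : U * U' * z * (V' * V) = U * (U' * z * V') * V := by simp only [mul_assoc]
  refine ⟨U * U', V' * V, a, ?_, ?_, ?_, ?_, ?_⟩
  · rw [← mul_one (U * U'), e, mul_one, h1, mul_one, hUV]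
  · rw [mul_assoc, ← mul_assoc V, hVU, one_mul, h2]
  · rw [e]
  · rw [e]; exact h _ h3
  · rw [e]
    simp only [coeff_zero_mul']

theorem HasLog.map {E' : Type*} [Ring E'] [Algebra k E'] {H' : Submodule k E'} {x : E} {g : E⟦X⟧}
    (hg : HasLog H x g) (f : E →ₐ[k] E') (h : ∀ x ∈ H, f x ∈ H') :
    HasLog H' (f x) (PowerSeries.map (f : E →+* E') g) := by
  obtain ⟨U, V, a, h1, h2, rfl, h3, rfl⟩ := hg
  have e : PowerSeries.map (f : E →+* E') U * PowerSeries.C (f a) *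
      PowerSeries.map (f : E →+* E') V =
        PowerSeries.map (f : E →+* E') (U * PowerSeries.C a * V) := by
    rw [map_mul, map_mul, PowerSeries.map_C]; rfl
  refine ⟨.map f U, .map f V, f a, ?_, ?_, ?_, ?_, ?_⟩
  · rw [← map_mul, h1, map_one]
  · rw [← map_mul, h2, map_one]
  · rw [map_mul, map_mul, map_expX]
  · intro d; rw [e, PowerSeries.coeff_map]; exact h _ (h3 d)
  · rw [e, PowerSeries.coeff_map]; rfl

theorem expX_nsmul [CharZero k] (a : E) (m : ℕ) : expX k ((m : k) • a) = expX k a ^ m := by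
  induction m with
  | zero => simp [expX_zero]
  | succ m ih =>
    rw [Nat.cast_succ, add_smul, one_smul, expX_add ((Commute.refl a).smul_left _), ih, pow_succ]

theorem conj_pow {M : Type*} [Monoid M] {u v : M} (huv : u * v = 1) (hvu : v * u = 1) (x : M)
    (m : ℕ) : (u * x * v) ^ m = u * x ^ m * v := by
  induction m with
  | zero => simp [huv]
  | succ m ih =>
    calc (u * x * v) ^ (m + 1) = u * x ^ m * (v * u) * x * v := by
          rw [pow_succ, ih]; simp only [mul_assoc]
      _ = u * x ^ (m + 1) * v := by rw [hvu, mul_one, pow_succ]; simp only [mul_assoc]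

/-- Needed because the subgroups considered may contain only powers of the $\xi_{ij}$. -/
theorem HasLog.pow [CharZero k] {x : E} {g : E⟦X⟧} (hg : HasLog H x g) (m : ℕ) :
    HasLog H ((m : k) • x) (g ^ m) := by
  obtain ⟨U, V, a, h1, h2, rfl, h3, rfl⟩ := hg
  have e (d : ℕ) : PowerSeries.coeff d (U * PowerSeries.C ((m : k) • a) * V) =
      (m : k) • PowerSeries.coeff d (U * PowerSeries.C a * V) := by
    simp only [coeff_mul_C_mul, Finset.smul_sum, mul_smul_comm, smul_mul_assoc]
  refine ⟨U, V, (m : k) • a, h1, h2, ?_, fun d => ?_, e 0⟩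
  · rw [conj_pow h1 h2, expX_nsmul]
  · rw [e]; exact H.smul_mem _ (h3 d)

end Conjugation

/-! ### Logarithms of the pure braids `ξ_{ij}` -/

section Strand

attribute [local instance] LieRing.ofAssociativeRing

variable (k : Type*) [Field k] {n : ℕ}

/-- The Lie algebra generated by the `t_{ir}`, `i ∈ S`. -/
def strandAlg (S : Set (Fin n)) (r : Fin n) : LieSubalgebra k (InfBraid k n) :=
  LieSubalgebra.lieSpan k _ {x | ∃ i ∈ S, x = braidT k i r}

variable {k}

theorem braidT_mem_strandAlg {S : Set (Fin n)} {i r : Fin n} (h : i ∈ S) :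
    braidT k i r ∈ strandAlg k S r :=
  LieSubalgebra.subset_lieSpan ⟨i, h, rfl⟩

theorem strandAlg_mono {S S' : Set (Fin n)} (h : S ⊆ S') (r : Fin n) :
    strandAlg k S r ≤ strandAlg k S' r :=
  LieSubalgebra.lieSpan_mono fun _ ⟨i, hi, e⟩ => ⟨i, h hi, e⟩

theorem commutator_mem_of_mem {E : Type*} [Ring E] [Algebra k E] {H : LieSubalgebra k E} {a : E}
    (ha : a ∈ H) : ∀ x ∈ H.toSubmodule, a * x - x * a ∈ H.toSubmodule :=
  fun _ hx => H.lie_mem ha hx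

/-- Since $\mathrm{ad}\,a$ is a derivation of the bracket, stability may be checked on generators.
The element `a` itself need not belong to the Lie algebra. -/
theorem commutator_mem_lieSpan {E : Type*} [Ring E] [Algebra k E] {S : Set E} {a : E}
    (h : ∀ x ∈ S, a * x - x * a ∈ LieSubalgebra.lieSpan k E S) :
    ∀ x ∈ (LieSubalgebra.lieSpan k E S).toSubmodule,
      a * x - x * a ∈ (LieSubalgebra.lieSpan k E S).toSubmodule := by
  intro x hx
  change ⁅a, x⁆ ∈ LieSubalgebra.lieSpan k E S
  induction hx using LieSubalgebra.lieSpan_induction with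
  | mem x hx => exact h x hx
  | zero => rw [lie_zero]; exact zero_mem _
  | add x y _ _ hx hy => rw [lie_add]; exact add_mem hx hy
  | smul c x _ hx => rw [lie_smul]; exact LieSubalgebra.smul_mem _ c hx
  | lie x y h1 h2 hx hy =>
    rw [leibniz_lie]
    exact add_mem (LieSubalgebra.lie_mem _ hx h2) (LieSubalgebra.lie_mem _ h1 hy)

/-- Stated for linear maps compatible with commutators, so as to cover both representations and
conjugation by a transposition. -/
theorem map_lieSpan_mem {E E' : Type*} [Ring E] [Algebra k E] [Ring E'] [Algebra k E']
    {S : Set E} {H : LieSubalgebra k E'} (f : E →ₗ[k] E')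
    (hf : ∀ x y, f (x * y - y * x) = f x * f y - f y * f x) (h : ∀ x ∈ S, f x ∈ H) :
    ∀ x ∈ (LieSubalgebra.lieSpan k E S).toSubmodule, f x ∈ H.toSubmodule := by
  intro x hx
  change f x ∈ H
  induction hx using LieSubalgebra.lieSpan_induction with
  | mem x hx => exact h x hx
  | zero => rw [map_zero]; exact zero_mem _
  | add x y _ _ hx hy => rw [map_add]; exact add_mem hx hy
  | smul c x _ hx => rw [map_smul]; exact H.smul_mem c hx
  | lie x y _ _ hx hy => rw [Ring.lie_def, hf]; exact H.lie_mem hx hy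

/-- The $t_{ab}$ with $a,b\in S$ normalize the algebra of the strand $r$ without being among its
generators: the four-term relation gives $[t_{ab},t_{ar}]=[t_{ar},t_{br}]$, and $t_{ab}$ commutes
with $t_{jr}$ for the remaining $j$. -/
theorem commutator_braidT_mem {S : Set (Fin n)} {a b r : Fin n} (ha : a ∈ S) (hb : b ∈ S)
    (hr : r ∉ S) : ∀ x ∈ (strandAlg k S r).toSubmodule,
      braidT k a b * x - x * braidT k a b ∈ (strandAlg k S r).toSubmodule := by
  refine commutator_mem_lieSpan ?_
  rintro _ ⟨j, hj, rfl⟩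
  have ht := braidT_rels k (n := n)
  by_cases hab : a = b
  · subst hab; rw [ht.diag]; simp
  have four {a b : Fin n} (ha : a ∈ S) (hb : b ∈ S) :
      braidT k a b * braidT k a r - braidT k a r * braidT k a b ∈ strandAlg k S r := by
    have e : braidT k a b * braidT k a r - braidT k a r * braidT k a b =
        braidT k a r * braidT k b r - braidT k b r * braidT k a r := by
      have h := ht.four a r b
      rw [mul_add, add_mul] at h
      rw [sub_eq_sub_iff_add_eq_add, ← h, add_comm]
    rw [e]
    exact LieSubalgebra.lie_mem _ (braidT_mem_strandAlg ha) (braidT_mem_strandAlg hb)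
  by_cases hja : j = a
  · subst hja; exact four ha hb
  by_cases hjb : j = b
  · subst hjb; rw [ht.symm a j]; exact four hb ha
  have hne {x : Fin n} (hx : x ∈ S) : x ≠ r := fun e => hr (e ▸ hx)
  rw [ht.comm a b j r hab (Ne.symm hja) (hne ha) (Ne.symm hjb) (hne hb) (hne hj), sub_self]
  exact zero_mem _

theorem commutator_sum_mem {E : Type*} [Ring E] [Algebra k E] {H : Submodule k E} {ι : Type*}
    (s : Finset ι) {f : ι → E} (h : ∀ i ∈ s, ∀ x ∈ H, f i * x - x * f i ∈ H) :
    ∀ x ∈ H, (∑ i ∈ s, f i) * x - x * ∑ i ∈ s, f i ∈ H := by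
  intro x hx
  rw [Finset.sum_mul, Finset.mul_sum, ← Finset.sum_sub_distrib]
  exact H.sum_mem fun i hi => h i hi x hx

variable {lam : k} {Φ : NCSeries k}

/-- The inverse of `drinfeldElt`. -/
noncomputable def drinfeldInv (lam : k) (Φ : NCSeries k) (i : Fin (n - 1)) : (InfBraid k n)⟦X⟧ :=
  Φ.eval (braidT k (lo i) (hi i)) (braidY k (lo i)) *
    expX k (lam • -braidT k (lo i) (hi i)) * PowerSeries.C (braidS k (transp i)) *
    Φ.eval (braidY k (lo i)) (braidT k (lo i) (hi i))

theorem IsAssociator.constCoeff_eval (hΦ : IsAssociator lam Φ) {E : Type*} [Ring E] [Algebra k E]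
    (a b : E) : PowerSeries.coeff 0 (Φ.eval a b) = 1 := by
  have h : Φ [] = 1 := by
    have := congrArg (PowerSeries.coeff 0) (hΦ.eval_zero (E := k))
    rw [eval_zero_zero] at this
    simpa using this
  simp only [NCSeries.eval, PowerSeries.coeff_mk]
  rw [Fintype.sum_eq_single List.Vector.nil (fun w hw => absurd (Subsingleton.elim w _) hw)]
  simp [wordEval, h]

theorem constCoeff_expX {E : Type*} [Ring E] [Algebra k E] (a : E) :
    PowerSeries.coeff 0 (expX k a) = 1 := by
  simp [expX]

theorem IsAssociator.constCoeff_drinfeldElt (hΦ : IsAssociator lam Φ) (i : Fin (n - 1)) :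
    PowerSeries.coeff 0 (drinfeldElt lam Φ i) = braidS k (transp i) := by
  simp only [drinfeldElt, braidElt, coeff_zero_mul', hΦ.constCoeff_eval, constCoeff_expX, PowerSeries.coeff_C, if_true,
    mul_one, one_mul]

theorem IsAssociator.constCoeff_drinfeldInv (hΦ : IsAssociator lam Φ) (i : Fin (n - 1)) :
    PowerSeries.coeff 0 (drinfeldInv lam Φ i) = braidS k (transp i) := by
  simp only [drinfeldInv, coeff_zero_mul', hΦ.constCoeff_eval, constCoeff_expX, PowerSeries.coeff_C, if_true,
    mul_one, one_mul]

variable [CharZero k]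

theorem IsAssociator.drinfeldHom_inv (hΦ : IsAssociator lam Φ) (i : Fin (n - 1)) :
    (((hΦ.drinfeldHom n (.of i))⁻¹ : ((InfBraid k n)⟦X⟧)ˣ) : (InfBraid k n)⟦X⟧) =
      drinfeldInv lam Φ i := by
  simp [IsAssociator.drinfeldHom, IsAssociator.drinfeldUnit, drinfeldInv]

/-- The image of $\sigma_i$ carries the algebra of the strand `lo i` into that of `hi i`. The
factors $\Phi(Y,t)$ and $e^{\lambda t}$ act inside an enlarged algebra at `lo i`, then $s_i$
exchanges the two strands, and the last factor $\Phi(t,Y)$ preserves the algebra at `hi i`. -/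
theorem IsAssociator.conjMaps_drinfeldElt (hΦ : IsAssociator lam Φ) (i : Fin (n - 1)) :
    ConjMaps (strandAlg k (Set.Iio (lo i)) (lo i)).toSubmodule
      (strandAlg k (Set.Iio (hi i)) (hi i)).toSubmodule
      (drinfeldElt lam Φ i) (drinfeldInv lam Φ i) := by
  have ht := braidT_rels k (n := n)
  have hlt : lo i < hi i := by simp [Fin.lt_def, lo, hi]
  -- The strand `hi i` is adjoined so that `H₁` contains `t` as well as `Y`.
  set H₁ := strandAlg k (Set.Iio (lo i) ∪ {hi i}) (lo i)
  set H₂ := strandAlg k (Set.Iio (hi i)) (hi i)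
  set t := braidT k (lo i) (hi i)
  set Y := braidY k (lo i)
  have t1 : t ∈ H₁ := by
    simp only [t, ht.symm (lo i)]
    exact braidT_mem_strandAlg (Or.inr rfl)
  have Y1 : Y ∈ H₁ := by
    refine H₁.toSubmodule.sum_mem fun j hj => braidT_mem_strandAlg (Or.inl ?_)
    simpa using hj
  have t2 : t ∈ H₂ := braidT_mem_strandAlg hlt
  have c1 : ConjMaps H₁.toSubmodule H₁.toSubmodule (Φ.eval Y t) (Φ.eval t Y) :=
    hΦ.conjMaps (commutator_mem_of_mem Y1) (commutator_mem_of_mem t1)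
  have c2 : ConjMaps H₁.toSubmodule H₁.toSubmodule (expX k (lam • t)) (expX k (lam • -t)) := by
    rw [smul_neg]
    exact conjMaps_expX (commutator_mem_of_mem (H₁.smul_mem lam t1))
  have c3 : ConjMaps H₁.toSubmodule H₂.toSubmodule (PowerSeries.C (braidS k (transp i)))
      (PowerSeries.C (braidS k (transp i))) := by
    refine conjMaps_C ?_
    refine map_lieSpan_mem ((LinearMap.mulRight k (braidS k (transp i))).comp
      (LinearMap.mulLeft k (braidS k (transp i)))) (fun x y => ?_) ?_
    · have hs := braidS_sq (k := k) i
      have e (x y : InfBraid k n) : braidS k (transp i) * (x * y) * braidS k (transp i) =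
          braidS k (transp i) * x * braidS k (transp i) *
            (braidS k (transp i) * y * braidS k (transp i)) := by
        calc _ = braidS k (transp i) * x * (1 * y) * braidS k (transp i) := by
              rw [one_mul, mul_assoc _ x y]
          _ = _ := by rw [← hs]; simp only [mul_assoc]
      simp only [LinearMap.comp_apply, LinearMap.mulRight_apply, LinearMap.mulLeft_apply, mul_sub,
        sub_mul, e]
    · rintro _ ⟨j, hj, rfl⟩
      simp only [LinearMap.comp_apply, LinearMap.mulRight_apply, LinearMap.mulLeft_apply]
      rw [(braidS_conj k (transp i) j (lo i)).eq, mul_assoc, braidS_sq, mul_one, transp_lo]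
      refine braidT_mem_strandAlg ?_
      rcases hj with hj | rfl
      · have hj' : (j : ℕ) < i := hj
        rw [transp_ne (by omega) (by omega)]
        exact lt_trans hj hlt
      · rw [transp_hi]; exact hlt
  have c4 : ConjMaps H₂.toSubmodule H₂.toSubmodule (Φ.eval t Y) (Φ.eval Y t) := by
    -- On this side `Y` is a sum of $t_{j,i}$ attached to another strand; it acts through
    -- `commutator_braidT_mem`, not by membership in `H₂`.
    refine hΦ.conjMaps (commutator_mem_of_mem t2) (commutator_sum_mem _ fun j hj => ?_)
    exact commutator_braidT_mem (lt_trans (by simpa using hj) hlt) hlt (by simp)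
  have h := c4.comp (c3.comp (c2.comp c1))
  have e1 : Φ.eval t Y * (PowerSeries.C (braidS k (transp i)) * (expX k (lam • t) * Φ.eval Y t)) =
      drinfeldElt lam Φ i := by
    simp only [drinfeldElt, braidElt, mul_assoc, t, Y]
  have e2 : Φ.eval t Y * expX k (lam • -t) * PowerSeries.C (braidS k (transp i)) * Φ.eval Y t =
      drinfeldInv lam Φ i := rfl
  rw [e1, e2] at h
  refine h.mono ?_ le_rfl
  exact strandAlg_mono Set.subset_union_left _

/-- In the square the inner associators cancel, and $s_i$ commutes with $t$ and squares to $1$,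
leaving $\Phi(t,Y)e^{2\lambda t}\Phi(Y,t)$. -/
theorem IsAssociator.hasLog_sq (hΦ : IsAssociator lam Φ) (i : Fin (n - 1)) :
    HasLog (strandAlg k (Set.Iio (hi i)) (hi i)).toSubmodule
      ((2 * lam) • braidT k (lo i) (hi i)) (drinfeldElt lam Φ i ^ 2) := by
  have hlt : lo i < hi i := by simp [Fin.lt_def, lo, hi]
  set H := strandAlg k (Set.Iio (hi i)) (hi i)
  set t := braidT k (lo i) (hi i)
  set Y := braidY k (lo i)
  have t2 : t ∈ H := braidT_mem_strandAlg hlt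
  have c : ConjMaps H.toSubmodule H.toSubmodule (Φ.eval t Y) (Φ.eval Y t) := by
    refine hΦ.conjMaps (commutator_mem_of_mem t2) (commutator_sum_mem _ fun j hj => ?_)
    exact commutator_braidT_mem (lt_trans (by simpa using hj) hlt) hlt (by simp)
  refine ⟨Φ.eval t Y, Φ.eval Y t, (2 * lam) • t, hΦ.mul_swap _ _, hΦ.mul_swap _ _, ?_, ?_, ?_⟩
  · set S : (InfBraid k n)⟦X⟧ := PowerSeries.C (braidS k (transp i))
    have hS : S * S = 1 := by rw [← map_mul, braidS_sq, map_one]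
    have st : Commute (braidS k (transp i)) t := by
      have h := braidS_conj k (transp i) (lo i) (hi i)
      rwa [transp_lo, transp_hi, (braidT_rels k).symm (hi i)] at h
    have hSe : expX k (lam • t) * S = S * expX k (lam • t) :=
      (semiconj_expX (semiconj_smul st lam)).eq.symm
    have he : expX k ((2 * lam) • t) = expX k (lam • t) * expX k (lam • t) := by
      rw [← expX_add (Commute.refl _), ← two_smul k (lam • t), smul_smul]
    calc drinfeldElt lam Φ i ^ 2 =
          Φ.eval t Y * S * expX k (lam • t) * (Φ.eval Y t * Φ.eval t Y) * S *
            expX k (lam • t) * Φ.eval Y t := by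
          rw [pow_two, drinfeldElt, braidElt]; simp only [mul_assoc, t, Y, S]
      _ = Φ.eval t Y * S * (expX k (lam • t) * S) * expX k (lam • t) * Φ.eval Y t := by
          rw [hΦ.mul_swap, mul_one, mul_assoc _ _ S]
      _ = Φ.eval t Y * (S * S) * expX k (lam • t) * expX k (lam • t) * Φ.eval Y t := by
          rw [hSe]; simp only [mul_assoc]
      _ = _ := by rw [hS, he, mul_one, mul_assoc (Φ.eval t Y)]
  · refine c _ fun d => ?_
    rw [PowerSeries.coeff_C]
    split_ifs
    · exact H.smul_mem _ t2
    · exact H.zero_mem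
  · simp only [coeff_zero_mul', hΦ.constCoeff_eval, PowerSeries.coeff_C, if_true, mul_one, one_mul]

/-- Each conjugation by the next Artin generator moves the logarithm to the algebra of the next
strand, and acts on its leading coefficient through the transposition alone, because associators and
exponentials have constant coefficient $1$. -/
theorem IsAssociator.hasLog_xiAux (hΦ : IsAssociator lam Φ) (i : ℕ) :
    ∀ (d : ℕ) (h : i + d + 1 < n),
      HasLog (strandAlg k (Set.Iio ⟨i + d + 1, h⟩) ⟨i + d + 1, h⟩).toSubmodule
        ((2 * lam) • braidT k ⟨i, by omega⟩ ⟨i + d + 1, h⟩)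
        (hΦ.drinfeldHom n (xiAux n i d) : (InfBraid k n)⟦X⟧) := by
  intro d
  induction d with
  | zero =>
    intro h
    have h' : i < n - 1 := by omega
    rw [xiAux, sigma, dif_pos h', map_pow, Units.val_pow_eq_pow_val, hΦ.drinfeldHom_of]
    exact hΦ.hasLog_sq ⟨i, h'⟩
  | succ d ih =>
    intro h
    -- Here `lo r` is the current last strand $i+d+1$ and `hi r` the next one; the transposition
    -- fixes the strand $i<i+d+1$.
    let r : Fin (n - 1) := ⟨i + d + 1, by omega⟩
    have hx := (ih (by omega)).conj (hΦ.conjMaps_drinfeldElt r)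
      (by rw [← hΦ.drinfeldHom_inv, ← hΦ.drinfeldHom_of, Units.mul_inv])
      (by rw [← hΦ.drinfeldHom_inv, ← hΦ.drinfeldHom_of, Units.inv_mul])
    rw [hΦ.constCoeff_drinfeldElt, hΦ.constCoeff_drinfeldInv, mul_smul_comm, smul_mul_assoc,
      (braidS_conj k (transp r) _ _).eq, mul_assoc, braidS_sq, mul_one,
      transp_ne (i := r) (a := ⟨i, by omega⟩) (by simp [r]; omega) (by simp [r]; omega),
      show (⟨i + d + 1, by omega⟩ : Fin n) = lo r from rfl, transp_lo] at hx
    rw [xiAux, sigma, dif_pos r.2, map_mul, map_mul, map_inv, Units.val_mul, Units.val_mul,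
      hΦ.drinfeldHom_of, hΦ.drinfeldHom_inv]
    exact hx

theorem IsAssociator.hasLog_xi (hΦ : IsAssociator lam Φ) {i j : Fin n} (hij : i < j) :
    HasLog (strandAlg k (Set.Iio j) j).toSubmodule ((2 * lam) • braidT k i j)
      (hΦ.drinfeldHom n (xi i j) : (InfBraid k n)⟦X⟧) := by
  have hj : (j : ℕ) = i + (j - i - 1) + 1 := by have : (i : ℕ) < j := hij; omega
  have h := hΦ.hasLog_xiAux (n := n) i (j - i - 1) (by omega)
  have e : (⟨i + (j - i - 1) + 1, by omega⟩ : Fin n) = j := Fin.ext hj.symm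
  rw [e] at h
  exact h

end Strand

/-! ### Algebraic hulls of monodromy representations -/

section Hull

attribute [local instance] LieRing.ofAssociativeRing

variable {k : Type*} [Field k] {n N : ℕ}

theorem HasLog.exists_isTangent [CharZero k] {H : Submodule k (Matrix (Fin N) (Fin N) k)}
    {x : Matrix (Fin N) (Fin N) k} {g : (Matrix (Fin N) (Fin N) k)⟦X⟧} (hg : HasLog H x g)
    {Γ : Submonoid (Matrix (Fin N) (Fin N) k⟦X⟧)} (h : matrixOfSeries k N g ∈ Γ) :
    ∃ y : (Matrix (Fin N) (Fin N) k)⟦X⟧, (∀ d, PowerSeries.coeff d y ∈ H) ∧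
      PowerSeries.coeff 0 y = x ∧ IsTangent Γ (matrixOfSeries k N y) := by
  obtain ⟨U, V, a, h1, h2, rfl, h3, rfl⟩ := hg
  refine ⟨_, h3, rfl, isTangent_of_exp h1 fun m => ?_⟩
  rw [expX_nsmul, ← conj_pow h1 h2, map_pow]
  exact Γ.pow_mem h m

/-- The set of matrices of a subgroup of `GL_N`. -/
def matrixImage {O B : Type*} [CommRing O] [Group B] (R : B →* GL (Fin N) O) (G : Subgroup B) :
    Submonoid (Matrix (Fin N) (Fin N) O) :=
  G.toSubmonoid.map ((Units.coeHom _).comp R)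

theorem mem_matrixImage {O B : Type*} [CommRing O] [Group B] (R : B →* GL (Fin N) O)
    {G : Subgroup B} {b : B} (hb : b ∈ G) :
    (R b : Matrix (Fin N) (Fin N) O) ∈ matrixImage R G :=
  ⟨b, hb, rfl⟩

/-- The logarithm of $\xi_{ij}^m$ has leading coefficient $2\lambda m\,\rho(t_{ij})$, while its
other coefficients involve all $\rho(t_{lj})$ with $l<j$. The last condition in `hS` ensures that
these stay in the Lie algebra generated by `S`, as `isTangent_of_reduction` requires. -/
theorem isTangent_monodromy [CharZero k] {lam : k} (hlam : lam ≠ 0) {Φ : NCSeries k}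
    (hΦ : IsAssociator lam Φ) (ρ : InfBraid k n →ₐ[k] Matrix (Fin N) (Fin N) k)
    {G : Subgroup (BraidGroup n)} {S : Set (Matrix (Fin N) (Fin N) k)}
    (hS : ∀ x ∈ S, ∃ i j : Fin n, i < j ∧ x = ρ (braidT k i j) ∧
      (∃ m : ℤ, m ≠ 0 ∧ xi i j ^ m ∈ G) ∧
      ∀ l < j, ρ (braidT k l j) ∈ LieSubalgebra.lieSpan k _ S)
    {x : Matrix (Fin N) (Fin N) k} (hx : x ∈ LieSubalgebra.lieSpan k _ S) :
    IsTangent (matrixImage (hΦ.monodromy ρ) G) (x.map PowerSeries.C) := by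
  refine isTangent_of_reduction (fun x hx => ?_) hx
  obtain ⟨i, j, hij, rfl, ⟨m, hm, hG⟩, hl⟩ := hS x hx
  -- A subgroup contains the inverse, so a positive exponent may be assumed.
  have hG' : xi i j ^ m.natAbs ∈ G := by
    rcases Int.natAbs_eq m with h | h
    · rwa [h, zpow_natCast] at hG
    · rw [h, zpow_neg, zpow_natCast] at hG
      exact inv_mem_iff.mp hG
  have h := ((hΦ.hasLog_xi hij).pow m.natAbs).map ρ
    (map_lieSpan_mem ρ.toLinearMap (fun x y => by simp) (by
      rintro _ ⟨l, hlj, rfl⟩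
      exact hl l hlj))
  rw [← Units.val_pow_eq_pow_val, ← map_pow] at h
  obtain ⟨y, hy, hy0, hyt⟩ := h.exists_isTangent (mem_matrixImage (hΦ.monodromy ρ) hG')
  have hc : (m.natAbs : k) * (2 * lam) ≠ 0 :=
    mul_ne_zero (by simpa using hm) (mul_ne_zero two_ne_zero hlam)
  -- The tangent matrix is rescaled to have leading coefficient exactly $\rho(t_{ij})$; this is
  -- where $\lambda\neq0$, $m\neq0$ and characteristic zero enter.
  refine ⟨((m.natAbs : k) * (2 * lam))⁻¹ • y, fun d => Submodule.smul_mem _ _ (hy d), ?_, ?_⟩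
  · refine (congrArg (((m.natAbs : k) * (2 * lam))⁻¹ • ·) hy0).trans ?_
    rw [map_smul, map_smul, smul_smul, smul_smul, mul_assoc, inv_mul_cancel₀ hc, one_smul]
  · rw [matrixOfSeries_smul]; exact hyt.smul _

theorem xiAux_mem_pureBraidGroup (n i d : ℕ) : xiAux n i d ∈ pureBraidGroup n := by
  induction d with
  | zero =>
    rw [xiAux, sigma]
    split_ifs with h
    · rw [pureBraidGroup, MonoidHom.mem_ker, map_pow, toPerm, PresentedGroup.toGroup.of, pow_two,
        transp, Equiv.swap_mul_self]
    · rw [one_pow]; exact one_mem _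
  | succ d ih => exact (MonoidHom.normal_ker _).conj_mem _ ih _

/-! ### Passage from power series to the quotient field of `A` -/

theorem evalAt_map {O O' : Type*} [CommRing O] [CommRing O'] (f : O →+* O')
    (p : MvPolynomial (Fin N × Fin N) O) (g : Matrix (Fin N) (Fin N) O) :
    evalAt (MvPolynomial.map f p) (g.map f) = f (evalAt p g) := by
  rw [evalAt, evalAt, MvPolynomial.eval_map, ← MvPolynomial.eval₂_id,
    MvPolynomial.eval₂_comp_left]
  rfl

theorem dirDeriv_map {O O' : Type*} [CommRing O] [CommRing O'] (f : O →+* O')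
    (p : MvPolynomial (Fin N × Fin N) O) (g v : Matrix (Fin N) (Fin N) O) :
    dirDeriv (MvPolynomial.map f p) (g.map f) (v.map f) = f (dirDeriv p g v) := by
  simp only [dirDeriv, map_sum, map_mul, MvPolynomial.pderiv_map, evalAt_map, Matrix.map_apply]

theorem exists_clear_denominators {O K σ : Type*} [CommRing O] [IsDomain O] [Field K]
    [Algebra O K] [IsFractionRing O K] (p : MvPolynomial σ K) :
    ∃ (a : O) (q : MvPolynomial σ O), a ≠ 0 ∧
      MvPolynomial.map (algebraMap O K) q = MvPolynomial.C (algebraMap O K a) * p := by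
  induction p using MvPolynomial.induction_on with
  | C c =>
    obtain ⟨x, y, hy, rfl⟩ := IsFractionRing.div_surjective (A := O) c
    refine ⟨y, .C x, nonZeroDivisors.ne_zero hy, ?_⟩
    have hy' : algebraMap O K y ≠ 0 := by
      simpa using nonZeroDivisors.ne_zero hy
    rw [MvPolynomial.map_C, ← map_mul, mul_div_cancel₀ _ hy']
  | add p p' hp hp' =>
    obtain ⟨a, q, ha, hq⟩ := hp
    obtain ⟨a', q', ha', hq'⟩ := hp'
    refine ⟨a * a', .C a' * q + .C a * q', mul_ne_zero ha ha', ?_⟩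
    simp only [map_add, map_mul, hq, hq', MvPolynomial.map_C]
    ring
  | mul_X p i hp =>
    obtain ⟨a, q, ha, hq⟩ := hp
    refine ⟨a, q * .X i, ha, ?_⟩
    rw [map_mul, hq, MvPolynomial.map_X, mul_assoc]

/-- A polynomial over `K` vanishing on the closure becomes, after clearing denominators, a
polynomial over `A`, and `A` embeds in both `K` and `k⟦X⟧`. Its vanishing on the image of `G` is
carried to `k⟦X⟧`, where tangency is known, and the vanishing of its derivative is carried back. -/
theorem extendScalars_le_lieAlg {B : Type*} [Group B] (R : B →* GL (Fin N) k⟦X⟧)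
    (A : Subalgebra k k⟦X⟧) (hR : ∀ b i j, (R b : Matrix (Fin N) (Fin N) k⟦X⟧) i j ∈ A)
    (K : Type*) [Field K] [Algebra A K] [IsFractionRing A K] {G : Subgroup B}
    {H : LieSubalgebra k (Matrix (Fin N) (Fin N) k)}
    (h : ∀ x ∈ H, IsTangent (matrixImage R G) (x.map PowerSeries.C)) :
    extendScalars A K H ≤ lieAlg (zariskiClosure (descend R A hR K '' G)) := by
  refine Submodule.span_le.mpr ?_
  rintro _ ⟨x, hx, rfl⟩ p hp
  change dirDeriv p 1 _ = 0
  obtain ⟨a, q, ha, hq⟩ := exists_clear_denominators (O := A) p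
  have hι : Function.Injective A.val := Subtype.val_injective
  have hK : Function.Injective (algebraMap A K) := IsFractionRing.injective A K
  have hvan : VanishesOn (matrixImage R G) (MvPolynomial.map A.val.toRingHom q) := by
    rintro _ ⟨b, hb, rfl⟩
    set g : Matrix (Fin N) (Fin N) A :=
      .of fun i j => ⟨(R b : Matrix (Fin N) (Fin N) k⟦X⟧) i j, hR b i j⟩
    have hg : (descend R A hR K b : Matrix (Fin N) (Fin N) K) = g.map (algebraMap A K) := rfl
    have hpb : evalAt p (g.map (algebraMap A K)) = 0 := by
      rw [← hg]
      -- The points of the image of `G` belong to their Zariski closure.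
      exact hp _ fun r hr => hr _ (Set.mem_image_of_mem _ hb)
    have hqb : evalAt q g = 0 := by
      refine hK ?_
      rw [← evalAt_map, hq, map_zero, evalAt, map_mul]
      exact mul_eq_zero_of_right _ hpb
    refine (evalAt_map A.val.toRingHom q g).trans ?_
    rw [hqb, map_zero]
  have hx' := h x hx _ hvan
  have e1 : x.map PowerSeries.C = (x.map (algebraMap k A)).map A.val.toRingHom := by
    ext1 i j; rfl
  rw [← Matrix.map_one A.val.toRingHom (map_zero _) (map_one _), e1, dirDeriv_map] at hx'
  have hx0 : dirDeriv q 1 (x.map (algebraMap k A)) = 0 := hι (by rw [map_zero]; exact hx')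
  have e2 := dirDeriv_map (algebraMap A K) q 1 (x.map (algebraMap k A))
  -- By the Leibniz rule, the derivative of $a\,p$ with $a$ constant is $a$ times that of $p$, and
  -- $a\neq0$.
  rw [hx0, map_zero, hq, dirDeriv_mul, dirDeriv_C, zero_mul, add_zero,
    Matrix.map_one _ (map_zero _) (map_one _)] at e2
  refine (mul_eq_zero.mp e2).resolve_left ?_
  rw [evalAt, MvPolynomial.eval_C]
  exact fun h0 => ha (hK (by rw [h0, map_zero]))

end Hull

end BraidHull

theorem mainTheorem10 {k : Type*} [Field k] [CharZero k] {n N : ℕ} (hn : 2 ≤ n) (hN : 1 ≤ N)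
    {lam : k} (hlam : lam ≠ 0) {Φ : NCSeries k} (hΦ : IsAssociator lam Φ)
    (ρ : InfBraid k n →ₐ[k] Matrix (Fin N) (Fin N) k)
    (A : Subalgebra k (PowerSeries k)) (hA : IsDVSubring A)
    (hR : ∀ b i j, (hΦ.monodromy ρ b : Matrix (Fin N) (Fin N) (PowerSeries k)) i j ∈ A)
    (K : Type*) [Field K] [Algebra A K] [IsFractionRing A K] :
    let R : BraidGroup n →* GL (Fin N) K := descend (hΦ.monodromy ρ) A hR K
    let 𝔥 : Subgroup (BraidGroup n) → Submodule K (Matrix (Fin N) (Fin N) K) :=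
      fun G => lieAlg (zariskiClosure (R '' G))
    -- the pure braid group and its free normal subgroup
    extendScalars A K (hol ρ) ≤ 𝔥 (pureBraidGroup n) ∧
    extendScalars A K (holLast ρ) ≤ 𝔥 (lastStrandGroup n) ∧
    (∀ m : ℤ, m ≠ 0 → extendScalars A K (holLast ρ) ≤ 𝔥 (lastStrandPowers n m)) ∧
    -- finite index subgroups, and subgroups containing fixed powers of the generators
    (∀ G : Subgroup (BraidGroup n), G.FiniteIndex → extendScalars A K (hol ρ) ≤ 𝔥 G) ∧
    (∀ G : Subgroup (BraidGroup n), ∀ m : ℤ, m ≠ 0 → (∀ i j : Fin n, i < j → xi i j ^ m ∈ G) →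
      extendScalars A K (hol ρ) ≤ 𝔥 G) ∧
    -- the groups generated by the powers of the Artin generators
    (∀ m : ℤ, m ≠ 0 →
      holConsecutive ρ = hol ρ →
      extendScalars A K (hol ρ) ≤ 𝔥 (rightAngledGroup n m)) := by
  intro R 𝔥
  let _ := LieRing.ofAssociativeRing (A := Matrix (Fin N) (Fin N) k)
  -- Generators are restricted to $i<j$, the pairs to which $\xi_{ij}$ is attached.
  have hol_eq : hol ρ =
      LieSubalgebra.lieSpan k _ {x | ∃ i j : Fin n, i < j ∧ x = ρ (braidT k i j)} := by
    refine le_antisymm (LieSubalgebra.lieSpan_le.mpr ?_)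
      (LieSubalgebra.lieSpan_mono fun x ⟨i, j, _, e⟩ => ⟨i, j, e⟩)
    rintro _ ⟨i, j, rfl⟩
    rcases lt_trichotomy i j with h | rfl | h
    · exact LieSubalgebra.subset_lieSpan ⟨i, j, h, rfl⟩
    · rw [(braidT_rels k).diag, map_zero]; exact zero_mem _
    · rw [(braidT_rels k).symm]
      exact LieSubalgebra.subset_lieSpan ⟨j, i, h, rfl⟩
  have full (G : Subgroup (BraidGroup n))
      (h : ∀ i j : Fin n, i < j → ∃ m : ℤ, m ≠ 0 ∧ xi i j ^ m ∈ G) :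
      extendScalars A K (hol ρ) ≤ 𝔥 G := by
    refine extendScalars_le_lieAlg _ A hR K fun x hx => ?_
    rw [hol_eq] at hx
    refine isTangent_monodromy hlam hΦ ρ ?_ hx
    rintro _ ⟨i, j, hij, rfl⟩
    exact ⟨i, j, hij, rfl, h i j hij, fun l hl => LieSubalgebra.subset_lieSpan ⟨l, j, hl, rfl⟩⟩
  have last (G : Subgroup (BraidGroup n)) (m : ℤ) (hm : m ≠ 0)
      (h : ∀ i j : Fin n, i < j → (j : ℕ) + 1 = n → xi i j ^ m ∈ G) :
      extendScalars A K (holLast ρ) ≤ 𝔥 G := by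
    refine extendScalars_le_lieAlg _ A hR K fun x hx => ?_
    refine isTangent_monodromy hlam hΦ ρ ?_ hx
    rintro _ ⟨i, j, hij, hj, rfl⟩
    exact ⟨i, j, hij, rfl, ⟨m, hm, h i j hij hj⟩,
      fun l hl => LieSubalgebra.subset_lieSpan ⟨l, j, hl, hj, rfl⟩⟩
  refine ⟨full _ fun i j hij => ⟨1, one_ne_zero, ?_⟩, last _ 1 one_ne_zero fun i j hij hj => ?_,
    fun m hm => last _ m hm fun i j hij hj => Subgroup.subset_closure ⟨i, j, hij, hj, rfl⟩,
    fun G hG => full G fun i j hij => ?_, fun G m hm h => full G fun i j hij => ⟨m, hm, h i j hij⟩,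
    fun m hm hgen => ?_⟩
  · rw [zpow_one]; exact xiAux_mem_pureBraidGroup _ _ _
  · rw [zpow_one]; exact Subgroup.subset_closure ⟨i, j, hij, hj, rfl⟩
  -- Some positive power of each element, with exponent at most the index, lies in `G`; the
  -- factorial of the index is a multiple of all such exponents.
  · refine ⟨(G.index.factorial : ℕ), by exact_mod_cast Nat.factorial_ne_zero _, ?_⟩
    rw [zpow_natCast]
    exact Subgroup.pow_mem_of_index_ne_zero_of_dvd hG.index_ne_zero _
      fun m h0 hm => Nat.dvd_factorial h0 hm
  · rw [← hgen]
    refine extendScalars_le_lieAlg _ A hR K fun x hx => ?_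
    refine isTangent_monodromy hlam hΦ ρ ?_ hx
    rintro _ ⟨i, rfl⟩
    refine ⟨lo i, hi i, by simp [Fin.lt_def, lo, hi], rfl, ⟨m, hm, ?_⟩, fun l _ => ?_⟩
    -- Since $\xi_{i,i+1}=\sigma_i^2$, the generator $\sigma_i^{2m}$ is $\xi_{i,i+1}^m$.
    · refine Subgroup.subset_closure ⟨i, i.2, ?_⟩
      have : xi (lo i) (hi i) = sigma n i ^ 2 := by simp [xi, lo, hi, xiAux]
      rw [this, zpow_mul]; rfl
    -- The logarithm of $\sigma_i^2$ involves every $t_{l,i+1}$ with $l\le i$, not only consecutive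
    -- ones; the generation hypothesis places their images in the algebra.
    · change _ ∈ holConsecutive ρ
      rw [hgen]
      exact LieSubalgebra.subset_lieSpan ⟨l, hi i, rfl⟩
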